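/- Let $k\ge 1$ be an integer. An interval $\sigma$-algebra is a $\sigma$-algebra $\mathscr F$ on $[0,1]$ generated by a finite partition of $[0,1]$ into intervals of positive length (its atoms). Let $\mathscr S_k(\mathscr F)$ be the space of functions $f:[0,1]\to\mathbb R$ that coincide on each atom of $\mathscr F$ with a polynomial of degree at most $k-1$ and, if $k\ge2$, belong to $C^{k-2}[0,1]$. Let $0=\tau_0<\dots<\tau_m=1$ be the endpoints of the atoms, let $N_0,\dots,N_{m+k-2}$ be the B-spline basis of $\mathscr S_k(\mathscr F)$, given by the Cox–de Boor recursion for the knots $\tau_0,\dots,\tau_m$ with $\tau_0$ and $\tau_m$ repeated $k$ times, and let $E_i=\operatorname{supp}N_i$. The $k$-regularity parameter of $\mathscr F$ is $$\gamma_k(\mathscr F)=\max_{0\le i<m+k-2}\max\Big(\frac{|E_i|}{|E_{i+1}|},\frac{|E_{i+1}|}{|E_i|}\Big)$$ (with value $0$ if $m=k=1$, when the maximum is over the empty set), where $|\cdot|$ is Lebesgue measure. Write $\mathbb E h=\int_0^1 h(x)\,dx$. **Proposition.** There is a function $C(k,\gamma)$ such that the following holds for every $k\ge1$. Let $\mathscr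 F_0\subseteq\mathscr F_1\subseteq\cdots$ be interval $\sigma$-algebras on $[0,1]$, let $f_n\in\mathscr S_k(\mathscr F_n)$ for all $n\ge0$, and set $X_n=\sum_{\ell\le n}f_\ell^2$. Then there are non-negative functions $g_n\in\mathscr S_k(\mathscr F_n)$ such that for each $n\ge0$, everywhere on $[0,1]$, 1. $g_n\le g_{n+1}$, 2. $X_n^{1/2}\le g_n$, and 3. $\mathbb E g_n\le C\big(k,\sup_{m\le n}\gamma_k(\mathscr F_m)\big)\,\mathbb E X_n^{1/2}$. -/

import Mathlib

open MeasureTheory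

noncomputable section

/-- A finite partition of `[0,1]` into intervals of positive length.  It is the same datum as the
interval σ-algebra that it generates: `parts` is the set of atoms of that σ-algebra.  The atoms may
be open, closed or half-open. -/
structure IntervalPartition where
  parts : Finset (Set unitInterval)
  ordConnected : ∀ A ∈ parts, A.OrdConnected
  volume_pos : ∀ A ∈ parts, 0 < volume A
  disjoint : (parts : Set (Set unitInterval)).PairwiseDisjoint id
  cover : ∀ x : unitInterval, ∃ A ∈ parts, x ∈ A

namespace IntervalPartition

/-- The interval σ-algebra on `[0,1]` generated by the partition. -/
abbrev sigmaAlgebra (P : IntervalPartition) : MeasurableSpace unitInterval :=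
  MeasurableSpace.generateFrom (P.parts : Set (Set unitInterval))

/-- Splines of order `k`: functions on `[0,1]` that are of class `C^{k-2}` on `[0,1]` (no condition
if `k = 1`) and coincide on each atom with a polynomial of order `k`, i.e. of degree `< k`. -/
def IsSpline (P : IntervalPartition) (k : ℕ) (f : unitInterval → ℝ) : Prop :=
  (2 ≤ k → ContDiffOn ℝ ((k - 2 : ℕ) : WithTop ℕ∞) (Set.IccExtend zero_le_one f) (Set.Icc 0 1)) ∧
  ∀ A ∈ P.parts, ∃ p : Polynomial ℝ, p.degree < (k : WithBot ℕ) ∧ ∀ x ∈ A, f x = p.eval (x : ℝ)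

/-- The left endpoint of a subset of `[0,1]`. -/
def leftEnd (A : Set unitInterval) : ℝ := sInf ((fun x : unitInterval => (x : ℝ)) '' A)

/-- The endpoints `0 = τ_0 < τ_1 < ⋯ < τ_m = 1` of the atoms. -/
def breakpoints (P : IntervalPartition) : Finset ℝ := insert 1 (P.parts.image leftEnd)

/-- The knots of the B-splines of order `k`: the breakpoints in increasing order, where `0` and `1`
are repeated `k` times, that is `t_0 = ⋯ = t_{k-1} = 0`, `t_{k-1+j} = τ_j`, and `t_i = 1` for
`i ≥ m + k - 1`. -/
def knot (P : IntervalPartition) (k i : ℕ) : ℝ :=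
  (P.breakpoints.sort (· ≤ ·)).getD (i - (k - 1)) 1

/-- The Cox–de Boor recursion for the knots `t`; `coxDeBoor P t d i` is the `i`-th B-spline of
degree `d`.  In degree `0` it is the indicator function of the atom between `t_i` and `t_{i+1}`,
and zero if `t_i = t_{i+1}`.  Quotients with zero denominator are zero, as usual. -/
def coxDeBoor (P : IntervalPartition) (t : ℕ → ℝ) : ℕ → ℕ → unitInterval → ℝ
  | 0, i => Set.indicator {x | t i < t (i + 1) ∧ ∃ A ∈ P.parts, x ∈ A ∧ leftEnd A = t i} 1
  | d + 1, i => fun x =>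
      ((x : ℝ) - t i) / (t (i + d + 1) - t i) * coxDeBoor P t d i x +
        (t (i + d + 2) - (x : ℝ)) / (t (i + d + 2) - t (i + 1)) * coxDeBoor P t d (i + 1) x

/-- The B-spline `N_i` of order `k ≥ 1`.  The B-spline basis consists of the `N_i` with
`0 ≤ i < m + k - 1`, where `m` is the number of atoms. -/
def bspline (P : IntervalPartition) (k i : ℕ) : unitInterval → ℝ :=
  P.coxDeBoor (P.knot k) (k - 1) i

/-- The length `|E_i|` of the support `E_i` of the B-spline `N_i` of order `k`. -/
def suppLength (P : IntervalPartition) (k i : ℕ) : ℝ :=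
  volume.real (tsupport (P.bspline k i))

/-- The `k`-regularity parameter `γ_k = max_i max (|E_i| / |E_{i+1}|, |E_{i+1}| / |E_i|)`, where `i`
runs over all indices with `i + 1 < m + k - 1`.  It is `0` if there is no such index, which happens
only for `k = m = 1`. -/
def regularity (P : IntervalPartition) (k : ℕ) : ℝ :=
  ⨆ i : Fin (P.parts.card + k - 2),
    max (P.suppLength k i / P.suppLength k (i + 1)) (P.suppLength k (i + 1) / P.suppLength k i)

end IntervalPartition

end

/-!
The constant depends on the order `k` only; write `d = k - 1`.  Let `E_{n,j}` be the support of the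
B-spline `N_{n,j}` of the `n`-th partition and let `J_{n,j}` be the longest atom in it, so that
`|E_{n,j}| ≤ k |J_{n,j}|`.  Put
`ν_{n,j} = c_k (|J_{n,j}|⁻¹ ∫_{J_{n,j}} X_n) ^ (1/2)`, let `w_{n,j}` be the maximum of `ν_{l,r}`
over all `l ≤ n` and `r` with `E_{n,j} ⊆ E_{l,r}`, and let `g_n = ∑ j, w_{n,j} N_{n,j}`.

* `X_n ^ (1/2) ≤ ∑ j, ν_{n,j} N_{n,j} ≤ g_n` is the local stability of the B-spline basis, combined
  with Minkowski's inequality (`exists_coeff_sqrt_sum_sq_le`).  The `j`-th coefficient of a spline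
  is the value at the inner knots of `N_{n,j}` of the polar form of any of its polynomial pieces in
  `E_{n,j}`.  The pieces on adjacent atoms differ by a multiple of `(x - τ) ^ d`, whose polar form
  vanishes if one argument is `τ`; hence the piece on the long atom `J_{n,j}` may be taken
  (`IsSpline.eq_sum_dualFunctional`), and there polynomials are controlled by their quadratic mean
  (`exists_taylor_coeff_sq_le`).
* `g_n ≤ g_{n+1}` follows from knot insertion: a B-spline of a partition is a combination with
  non-negative coefficients of the B-splines of a finer partition whose supports lie in its own, and
  the B-splines sum to one (`blossom_window_nonneg`, `sum_mul_bspline_le_of_refine`).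
* For the integral, `X_l` is a sum of squares of polynomials of degree at most `d` on `J_{l,r}`, so
  it is at least half its mean on a fixed proportion of `J_{l,r}`.  Thus each `E_{l,r}` with
  `ν_{l,r} > s` has a fixed proportion on which `X_n ^ (1/2) ≥ X_l ^ (1/2) > s / C`.  As
  `{g_n > s}` is covered by these `E_{l,r}`, Vitali's covering lemma (`volume_biUnion_Icc_le`)
  bounds its measure by that of `{C X_n ^ (1/2) > s}`, and integration over `s` gives the claim.

All of this rests on the algebra of polar forms: if in the Cox–de Boor recursion the variable is
replaced by a new argument in each step, the result is symmetric and affine in each argument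
(`isPolarForm_blossom`), and any function with this property is the combination of the B-splines
with its values at the inner knots as coefficients (`sum_window_mul_blossom`).  In particular,
adjacent polynomial pieces of a B-spline differ by a multiple of `(x - τ) ^ d`
(`blossom_sub_blossom`), which shows that B-splines are splines.
-/

/-! ### Polar forms of B-splines -/

namespace BSpline

/-- The polar form (blossom) of the `i`-th B-spline of degree `d` for the knots `t` on the knot
interval `[t a, t (a + 1)]`, evaluated at a list of `d` arguments.  It replaces the variable of the
Cox–de Boor recursion by a new argument in each step.  On lists of a different length the value is
meaningless. -/
noncomputable def blossom (t : ℕ → ℝ) (a : ℕ) : ℕ → ℕ → List ℝ → ℝ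
  | 0, i, _ => if i = a then 1 else 0
  | _ + 1, _, [] => 0
  | d + 1, i, y :: L =>
      (y - t i) / (t (i + d + 1) - t i) * blossom t a d i L +
        (t (i + d + 2) - y) / (t (i + d + 2) - t (i + 1)) * blossom t a d (i + 1) L

/-- The list `t (j + 1), …, t (j + d)` of the inner knots of the `j`-th B-spline of degree `d`. -/
def window (t : ℕ → ℝ) : ℕ → ℕ → List ℝ
  | _, 0 => []
  | j, d + 1 => t (j + 1) :: window t (j + 1) d

/-- Symmetric functions of `d` real arguments that are affine in each of them. -/
structure IsPolarForm (d : ℕ) (B : List ℝ → ℝ) : Prop where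
  perm : ∀ L L' : List ℝ, L.length = d → L.Perm L' → B L = B L'
  affine : ∀ (r x y : ℝ) (L : List ℝ), L.length + 1 = d →
    B ((r * x + (1 - r) * y) :: L) = r * B (x :: L) + (1 - r) * B (y :: L)

variable {t : ℕ → ℝ} {a : ℕ}

@[simp] lemma length_window (t : ℕ → ℝ) (j d : ℕ) : (window t j d).length = d := by
  induction d generalizing j with
  | zero => rfl
  | succ d ih => simp [window, ih]

lemma window_succ_eq_append (t : ℕ → ℝ) (j d : ℕ) :
    window t j (d + 1) = window t j d ++ [t (j + d + 1)] := by
  induction d generalizing j with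
  | zero => simp [window]
  | succ d ih =>
    rw [window, ih (j + 1), window, List.cons_append]
    congr 4
    omega

lemma window_succ_perm (t : ℕ → ℝ) (j d : ℕ) :
    (window t j (d + 1)).Perm (t (j + d + 1) :: window t j d) := by
  rw [window_succ_eq_append]
  exact List.perm_append_singleton _ _

lemma mem_window {x : ℝ} {j d : ℕ} :
    x ∈ window t j d ↔ ∃ l, j < l ∧ l ≤ j + d ∧ t l = x := by
  induction d generalizing j with
  | zero =>
    simp only [window, List.not_mem_nil, false_iff]
    rintro ⟨l, h1, h2, -⟩
    omega
  | succ d ih =>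
    rw [window, List.mem_cons, ih]
    constructor
    · rintro (rfl | ⟨l, h1, h2, h3⟩)
      · exact ⟨j + 1, by omega, by omega, rfl⟩
      · exact ⟨l, by omega, by omega, h3⟩
    · rintro ⟨l, h1, h2, h3⟩
      rcases eq_or_ne l (j + 1) with rfl | h
      · exact Or.inl h3.symm
      · exact Or.inr ⟨l, by omega, by omega, h3⟩

lemma blossom_eq_zero {d i : ℕ} (h : ¬(i ≤ a ∧ a ≤ i + d)) (L : List ℝ) :
    blossom t a d i L = 0 := by
  induction d generalizing i L with
  | zero =>
    rw [blossom, if_neg]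
    rintro rfl
    exact h ⟨le_rfl, by omega⟩
  | succ d ih =>
    cases L with
    | nil => rfl
    | cons y L => rw [blossom, ih (by omega), ih (by omega), mul_zero, mul_zero, add_zero]

lemma index_bounds_of_blossom_ne_zero {d i : ℕ} {L : List ℝ} (h : blossom t a d i L ≠ 0) :
    i ≤ a ∧ a ≤ i + d := by
  by_contra h'
  exact h (blossom_eq_zero h' L)

lemma blossom_swap (ht : Monotone t) (d i : ℕ) (x y : ℝ) (L : List ℝ) :
    blossom t a (d + 2) i (y :: x :: L) = blossom t a (d + 2) i (x :: y :: L) := by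
  simp only [blossom]
  have e1 : i + (d + 1) + 1 = i + d + 2 := by ring
  have e2 : i + 1 + d + 1 = i + d + 2 := by ring
  have e3 : i + (d + 1) + 2 = i + d + 3 := by ring
  have e4 : i + 1 + d + 2 = i + d + 3 := by ring
  have e5 : i + 1 + 1 = i + 2 := by ring
  simp only [e1, e2, e3, e4, e5]
  -- The coefficients of the outer two blossoms are symmetric in `x` and `y`.  That of the middle
  -- one vanishes if its denominator does; otherwise no denominator in it vanishes.
  rcases (ht (show i + 1 ≤ i + d + 2 by omega)).eq_or_lt with h | h
  · rw [h]
    ring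
  · have h1 : t (i + d + 2) - t (i + 1) ≠ 0 := by linarith
    have h2 : t (i + d + 2) - t i ≠ 0 := by
      have := ht (show i ≤ i + 1 by omega)
      linarith
    have h3 : t (i + d + 3) - t (i + 1) ≠ 0 := by
      have := ht (show i + d + 2 ≤ i + d + 3 by omega)
      linarith
    have key : (y - t i) / (t (i + d + 2) - t i) *
          ((t (i + d + 2) - x) / (t (i + d + 2) - t (i + 1))) +
        (t (i + d + 3) - y) / (t (i + d + 3) - t (i + 1)) *
          ((x - t (i + 1)) / (t (i + d + 2) - t (i + 1))) =
        (x - t i) / (t (i + d + 2) - t i) *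
          ((t (i + d + 2) - y) / (t (i + d + 2) - t (i + 1))) +
        (t (i + d + 3) - x) / (t (i + d + 3) - t (i + 1)) *
          ((y - t (i + 1)) / (t (i + d + 2) - t (i + 1))) := by
      field_simp
      ring
    linear_combination blossom t a d (i + 1) L * key

lemma blossom_perm (ht : Monotone t) {L L' : List ℝ} (h : L.Perm L') :
    ∀ d i, L.length = d → blossom t a d i L = blossom t a d i L' := by
  induction h with
  | nil => intros; rfl
  | cons x _ ih =>
    intro d i hd
    obtain _ | d := d
    · rfl
    · rw [blossom, blossom, ih d i (by simpa using hd), ih d (i + 1) (by simpa using hd)]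
  | swap x y L =>
    intro d i hd
    obtain _ | _ | d := d
    · simp at hd
    · simp at hd
    · exact blossom_swap ht d i x y L
  | trans h1 _ ih1 ih2 =>
    intro d i hd
    rw [ih1 d i hd, ih2 d i (by rw [← h1.length_eq, hd])]

lemma isPolarForm_blossom (ht : Monotone t) (a d i : ℕ) :
    IsPolarForm d (blossom t a d i) where
  perm _ _ hd h := blossom_perm ht h d i hd
  affine r x y L hd := by
    subst hd
    simp only [blossom]
    ring

lemma isPolarForm_one (d : ℕ) : IsPolarForm d (fun _ => 1) :=
  ⟨fun _ _ _ _ => rfl, fun r _ _ _ _ => by ring⟩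

/-- The polar form of `(x - c) ^ d`. -/
lemma isPolarForm_prod (d : ℕ) (c : ℝ) : IsPolarForm d (fun L => (L.map (· - c)).prod) where
  perm _ _ _ h := (h.map _).prod_eq
  affine r x y L _ := by
    simp only [List.map_cons, List.prod_cons]
    ring

lemma IsPolarForm.sub_sub_mul {d : ℕ} {B B' B'' : List ℝ → ℝ} (h : IsPolarForm d B)
    (h' : IsPolarForm d B') (h'' : IsPolarForm d B'') (c : ℝ) :
    IsPolarForm d (fun L => B L - B' L - c * B'' L) where
  perm L L' hd hL := by rw [h.perm L L' hd hL, h'.perm L L' hd hL, h''.perm L L' hd hL]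
  affine r x y L hd := by
    rw [h.affine r x y L hd, h'.affine r x y L hd, h''.affine r x y L hd]
    ring

lemma IsPolarForm.cons {d : ℕ} {B : List ℝ → ℝ} (h : IsPolarForm (d + 1) B) (x : ℝ) :
    IsPolarForm d (fun L => B (x :: L)) where
  perm L L' hd hL := h.perm _ _ (by simpa using hd) (hL.cons x)
  affine r y z L hd := by
    have sw : ∀ w, B (x :: w :: L) = B (w :: x :: L) := fun w =>
      h.perm _ _ (by simpa using hd) (List.Perm.swap _ _ _)
    simp only [sw]
    exact h.affine r y z (x :: L) (by simpa using hd)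

/-- The polar form of Marsden's identity: a symmetric multiaffine function is the combination of the
blossoms of the B-splines whose coefficients are its values at the inner knots. -/
theorem sum_window_mul_blossom (ht : Monotone t) (ha : t a < t (a + 1)) {d M : ℕ} (hd : d ≤ a)
    (hM : a < M) {B : List ℝ → ℝ} (hB : IsPolarForm d B) {L : List ℝ} (hL : L.length = d) :
    ∑ j ∈ Finset.range M, B (window t j d) * blossom t a d j L = B L := by
  induction d generalizing B L with
  | zero =>
    obtain rfl := List.length_eq_zero_iff.mp hL
    simp only [window, blossom, mul_ite, mul_one, mul_zero, Finset.sum_ite_eq', Finset.mem_range,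
      hM, if_true]
  | succ d ih =>
    obtain _ | ⟨x, L⟩ := L
    · simp at hL
    have hL' : L.length = d := by simpa using hL
    rw [← ih (by omega) (hB.cons x) hL']
    set F : ℕ → ℝ := fun j => B (window t (j - 1) (d + 1)) *
      ((t (j + d + 1) - x) / (t (j + d + 1) - t j) * blossom t a d j L) with hF
    have shift : ∑ j ∈ Finset.range M, F (j + 1) = ∑ j ∈ Finset.range M, F j := by
      have h1 := Finset.sum_range_succ F M
      have h2 := Finset.sum_range_succ' F M
      have h3 : F 0 = 0 := by
        simp only [hF, blossom_eq_zero (t := t) (show ¬(0 ≤ a ∧ a ≤ 0 + d) by omega), mul_zero]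
      have h4 : F M = 0 := by
        simp only [hF, blossom_eq_zero (t := t) (show ¬(M ≤ a ∧ a ≤ M + d) by omega), mul_zero]
      linarith
    have step : ∑ j ∈ Finset.range M, B (window t j (d + 1)) * blossom t a (d + 1) j (x :: L) =
        ∑ j ∈ Finset.range M, (B (window t j (d + 1)) *
          ((x - t j) / (t (j + d + 1) - t j) * blossom t a d j L) + F j) := by
      rw [Finset.sum_add_distrib, ← shift, ← Finset.sum_add_distrib]
      refine Finset.sum_congr rfl fun j _ => ?_
      have e : j + 1 + d + 1 = j + d + 2 := by ring
      simp only [hF, blossom, e, Nat.add_sub_cancel]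
      ring
    rw [step]
    refine Finset.sum_congr rfl fun j _ => ?_
    by_cases h0 : blossom t a d j L = 0
    · simp [hF, h0]
    obtain ⟨h1, h2⟩ := index_bounds_of_blossom_ne_zero h0
    obtain ⟨j, rfl⟩ : ∃ i, j = i + 1 := ⟨j - 1, by omega⟩
    have hlt : t (j + 1) < t (j + 1 + d + 1) :=
      (ht h1).trans_lt (ha.trans_le (ht (by omega)))
    have e1 : B (window t (j + 1) (d + 1)) = B (t (j + 1 + d + 1) :: window t (j + 1) d) :=
      hB.perm _ _ (by simp) (window_succ_perm t (j + 1) d)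
    have hne : t (j + 1 + d + 1) - t (j + 1) ≠ 0 := by linarith
    set r := (x - t (j + 1)) / (t (j + 1 + d + 1) - t (j + 1)) with hr
    have e2 : (t (j + 1 + d + 1) - x) / (t (j + 1 + d + 1) - t (j + 1)) = 1 - r := by
      rw [hr]
      field_simp
      ring
    have e3 : x = r * t (j + 1 + d + 1) + (1 - r) * t (j + 1) := by
      rw [hr]
      field_simp
      ring
    have e4 : B (x :: window t (j + 1) d) = r * B (t (j + 1 + d + 1) :: window t (j + 1) d) +
        (1 - r) * B (t (j + 1) :: window t (j + 1) d) := by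
      conv_lhs => rw [e3]
      exact hB.affine _ _ _ _ (by simp)
    simp only [hF, Nat.add_sub_cancel]
    rw [e4, e1, e2, window]
    ring

/-- The inner knots of the B-splines give the functionals dual to the B-splines. -/
theorem blossom_window (ht : Monotone t) (ha : t a < t (a + 1)) {d j : ℕ} (h1 : j ≤ a)
    (h2 : a ≤ j + d) (i : ℕ) :
    blossom t a d i (window t j d) = if i = j then 1 else 0 := by
  induction d generalizing i j with
  | zero =>
    obtain rfl : j = a := by omega
    rfl
  | succ d ih =>
    by_cases h3 : a ≤ j + d
    · rw [blossom_perm ht (window_succ_perm t j d) _ _ (by simp), blossom, ih h1 h3, ih h1 h3]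
      rcases eq_or_ne i j with rfl | hij
      · have : t i < t (i + d + 1) := (ht h1).trans_lt (ha.trans_le (ht (by omega)))
        have hne : t (i + d + 1) - t i ≠ 0 := by linarith
        simp [hne]
      · rcases eq_or_ne (i + 1) j with rfl | hij'
        · have e : i + 1 + d + 1 = i + d + 2 := by ring
          simp [e]
        · simp [hij, hij']
    · rw [window, blossom, ih (j := j + 1) (by omega) (by omega),
        ih (j := j + 1) (by omega) (by omega)]
      rcases eq_or_ne i j with rfl | hij
      · have : t (i + 1) < t (i + d + 2) :=
          (ht (show i + 1 ≤ a by omega)).trans_lt (ha.trans_le (ht (by omega)))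
        have hne : t (i + d + 2) - t (i + 1) ≠ 0 := by linarith
        simp [hne]
      · rcases eq_or_ne i (j + 1) with rfl | hij'
        · simp
        · simp [hij, hij']

/-- On its own knot interval a B-spline is non-negative. -/
lemma blossom_replicate_nonneg (ht : Monotone t) {x : ℝ} (h1 : t a ≤ x) (h2 : x ≤ t (a + 1))
    (d i : ℕ) : 0 ≤ blossom t a d i (List.replicate d x) := by
  induction d generalizing i with
  | zero =>
    rw [blossom]
    split_ifs <;> norm_num
  | succ d ih =>
    rw [List.replicate_succ, blossom]
    refine add_nonneg ?_ ?_
    · by_cases h : i ≤ a ∧ a ≤ i + d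
      · have := ht h.1
        have := ht (show i ≤ i + d + 1 by omega)
        exact mul_nonneg (div_nonneg (by linarith) (by linarith)) (ih i)
      · rw [blossom_eq_zero h, mul_zero]
    · by_cases h : i + 1 ≤ a ∧ a ≤ i + 1 + d
      · have := ht (show a + 1 ≤ i + d + 2 by omega)
        have := ht (show i + 1 ≤ i + d + 2 by omega)
        exact mul_nonneg (div_nonneg (by linarith) (by linarith)) (ih (i + 1))
      · rw [blossom_eq_zero h, mul_zero]

/-- Knot insertion.  Let the knots `t` in `[0, 1]`, of which those in `(0, 1)` are simple, be among
the knots `s`.  Then the coefficients of a B-spline for `t` with respect to the B-splines for `s`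
are non-negative, and they vanish unless the interval of the latter lies in that of the former.

The proof peels off the last or the first inner knot of the window, such that the knot interval
`[s b, s (b + 1)]` remains inside the window. -/
theorem blossom_window_nonneg {s : ℕ → ℝ} {b : ℕ} (ht : Monotone t) (hs : Monotone s)
    (hsimple : ∀ i, 0 < t i → t i < 1 → t i < t (i + 1))
    (hs0 : ∀ i, 0 ≤ s i) (hs1 : ∀ i, s i ≤ 1)
    (hbetween : ∀ i j, s j < t i → s (j + 1) ≤ t i)
    (hb : s b < s (b + 1)) (hab : t a ≤ s b) (hba : s (b + 1) ≤ t (a + 1))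
    {d j : ℕ} (h1 : j ≤ b) (h2 : b ≤ j + d) (i : ℕ) :
    0 ≤ blossom t a d i (window s j d) ∧ (blossom t a d i (window s j d) ≠ 0 →
      t i ≤ s j ∧ s (j + d + 1) ≤ t (i + d + 1)) := by
  induction d generalizing i j with
  | zero =>
    obtain rfl : j = b := by omega
    rw [blossom]
    split_ifs with h
    · subst h
      exact ⟨zero_le_one, fun _ => ⟨hab, hba⟩⟩
    · exact ⟨le_rfl, fun h => absurd rfl h⟩
  | succ d ih =>
    change _ ∧ (_ → t i ≤ s j ∧ s (j + d + 2) ≤ t (i + d + 2))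
    by_cases h3 : b ≤ j + d
    · rw [blossom_perm ht (window_succ_perm s j d) _ _ (by simp), blossom]
      obtain ⟨p1, q1⟩ := ih h1 h3 i
      obtain ⟨p2, q2⟩ := ih h1 h3 (i + 1)
      have e : i + 1 + d + 1 = i + d + 2 := by ring
      rw [e] at q2
      have hsj := hs (show j ≤ j + d + 1 by omega)
      have ht1 := ht (show i ≤ i + d + 1 by omega)
      have ht2 := ht (show i + 1 ≤ i + d + 2 by omega)
      have ht3 := ht (show i ≤ i + 1 by omega)
      have ht4 := ht (show i + d + 1 ≤ i + d + 2 by omega)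
      refine ⟨add_nonneg ?_ ?_, fun hne => ?_⟩
      · by_cases h : blossom t a d i (window s j d) = 0
        · rw [h, mul_zero]
        · obtain ⟨q, -⟩ := q1 h
          exact mul_nonneg (div_nonneg (by linarith) (by linarith)) p1
      · by_cases h : blossom t a d (i + 1) (window s j d) = 0
        · rw [h, mul_zero]
        · obtain ⟨-, q⟩ := q2 h
          exact mul_nonneg (div_nonneg (by linarith) (by linarith)) p2
      · by_cases h : (s (j + d + 1) - t i) / (t (i + d + 1) - t i) *
            blossom t a d i (window s j d) = 0
        · rw [h, zero_add] at hne
          obtain ⟨q3, q4⟩ := q2 (right_ne_zero_of_mul hne)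
          refine ⟨by linarith, hbetween (i + d + 2) (j + d + 1) (lt_of_le_of_ne q4 fun h' => ?_)⟩
          rw [h', sub_self, zero_div, zero_mul] at hne
          exact hne rfl
        · obtain ⟨q3, q4⟩ := q1 (right_ne_zero_of_mul h)
          refine ⟨by linarith, ?_⟩
          by_contra! h'
          -- Otherwise the inner knot `s (j + d + 1)` of `t` is at least double.
          have h5 : ¬ s (j + d + 1) < t (i + d + 2) := fun h'' =>
            absurd (hbetween _ _ h'') (not_le.mpr h')
          have h6 := hs (show b + 1 ≤ j + d + 1 by omega)
          have h7 := hsimple (i + d + 1) (by linarith [hs0 b])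
            (by linarith [hs1 (j + d + 2)])
          have h8 : t (i + d + 1 + 1) = t (i + d + 2) := rfl
          linarith
    · rw [window, blossom]
      obtain ⟨p1, q1⟩ := ih (j := j + 1) (by omega) (by omega) i
      obtain ⟨p2, q2⟩ := ih (j := j + 1) (by omega) (by omega) (i + 1)
      have e : i + 1 + d + 1 = i + d + 2 := by ring
      have e' : j + 1 + d + 1 = j + d + 2 := by ring
      rw [e'] at q1
      rw [e, e'] at q2
      have hsj := hs (show j + 1 ≤ j + d + 2 by omega)
      have ht1 := ht (show i ≤ i + d + 1 by omega)
      have ht2 := ht (show i + 1 ≤ i + d + 2 by omega)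
      have ht3 := ht (show i ≤ i + 1 by omega)
      have ht4 := ht (show i + d + 1 ≤ i + d + 2 by omega)
      refine ⟨add_nonneg ?_ ?_, fun hne => ?_⟩
      · by_cases h : blossom t a d i (window s (j + 1) d) = 0
        · rw [h, mul_zero]
        · obtain ⟨q, -⟩ := q1 h
          exact mul_nonneg (div_nonneg (by linarith) (by linarith)) p1
      · by_cases h : blossom t a d (i + 1) (window s (j + 1) d) = 0
        · rw [h, mul_zero]
        · obtain ⟨-, q⟩ := q2 h
          exact mul_nonneg (div_nonneg (by linarith) (by linarith)) p2
      · by_cases h : (s (j + 1) - t i) / (t (i + d + 1) - t i) *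
            blossom t a d i (window s (j + 1) d) = 0
        · rw [h, zero_add] at hne
          obtain ⟨q3, q4⟩ := q2 (right_ne_zero_of_mul hne)
          refine ⟨?_, q4⟩
          by_contra! h'
          -- Otherwise the inner knot `s (j + 1)` of `t` is at least double.
          have h5 := hbetween _ _ h'
          have h6 := hs (show j + 1 ≤ b by omega)
          have h7 := hsimple i (by linarith [hs0 j]) (by linarith [hs1 (b + 1)])
          linarith
        · obtain ⟨q3, q4⟩ := q1 (right_ne_zero_of_mul h)
          refine ⟨?_, q4.trans ht4⟩
          by_contra! h'
          have h5 := hbetween _ _ h'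
          have h6 : s (j + 1) = t i := le_antisymm h5 q3
          rw [h6, sub_self, zero_div, zero_mul] at h
          exact h rfl

end BSpline

/-! ### Atoms, breakpoints and knots -/

namespace IntervalPartition

open BSpline

variable {P Q : IntervalPartition} {A B : Set unitInterval} {k : ℕ}

lemma bddBelow_coe_image (A : Set unitInterval) :
    BddBelow ((fun x : unitInterval => (x : ℝ)) '' A) :=
  ⟨0, by rintro _ ⟨x, -, rfl⟩; exact x.2.1⟩

lemma leftEnd_le {x : unitInterval} (hx : x ∈ A) : leftEnd A ≤ x :=
  csInf_le (bddBelow_coe_image A) ⟨x, hx, rfl⟩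

lemma exists_mem_leftEnd_lt (hA : A ∈ P.parts) : ∃ y ∈ A, leftEnd A < y := by
  have hnt : A.Nontrivial := by
    by_contra h
    rw [Set.not_nontrivial_iff] at h
    exact (P.volume_pos A hA).ne' (h.measure_zero _)
  obtain ⟨x, hx, y, hy, hxy⟩ := hnt.exists_lt
  exact ⟨y, hy, (leftEnd_le hx).trans_lt hxy⟩

lemma nonempty_of_mem_parts (hA : A ∈ P.parts) : A.Nonempty :=
  (exists_mem_leftEnd_lt hA).imp fun _ h => h.1

lemma leftEnd_nonneg (hA : A ∈ P.parts) : 0 ≤ leftEnd A :=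
  le_csInf ((nonempty_of_mem_parts hA).image _) (by rintro _ ⟨x, -, rfl⟩; exact x.2.1)

lemma leftEnd_lt_one (hA : A ∈ P.parts) : leftEnd A < 1 := by
  obtain ⟨y, -, h⟩ := exists_mem_leftEnd_lt hA
  exact h.trans_le y.2.2

lemma mem_of_leftEnd_lt (hA : A ∈ P.parts) {y z : unitInterval} (hz : z ∈ A)
    (hy : leftEnd A < y) (hyz : y ≤ z) : y ∈ A := by
  obtain ⟨_, ⟨x, hx, rfl⟩, hxy⟩ :=
    exists_lt_of_csInf_lt ((nonempty_of_mem_parts hA).image _) hy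
  exact (P.ordConnected A hA).out hx hz ⟨le_of_lt hxy, hyz⟩

lemma eq_of_mem_of_mem (hA : A ∈ P.parts) (hB : B ∈ P.parts) {x : unitInterval} (hxA : x ∈ A)
    (hxB : x ∈ B) : A = B := by
  by_contra h
  exact Set.disjoint_left.mp (P.disjoint hA hB h) hxA hxB

lemma eq_of_leftEnd_le (hA : A ∈ P.parts) (hB : B ∈ P.parts) {y : unitInterval} (hy : y ∈ B)
    (h1 : leftEnd B ≤ leftEnd A) (h2 : leftEnd A < y) : A = B := by
  obtain ⟨r, hr, hr'⟩ := exists_mem_leftEnd_lt hA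
  have hz : leftEnd A < ((min r y : unitInterval) : ℝ) := by
    rcases min_choice r y with h | h <;> rwa [h]
  exact eq_of_mem_of_mem hA hB (mem_of_leftEnd_lt hA hr hz (min_le_left _ _))
    (mem_of_leftEnd_lt hB hy (h1.trans_lt hz) (min_le_right _ _))

lemma leftEnd_injOn (P : IntervalPartition) :
    Set.InjOn leftEnd (P.parts : Set (Set unitInterval)) := by
  intro A hA B hB h
  obtain ⟨y, hy, hy'⟩ := exists_mem_leftEnd_lt hB
  exact eq_of_leftEnd_le hA hB hy h.ge (h ▸ hy')

lemma mem_breakpoints {x : ℝ} :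
    x ∈ P.breakpoints ↔ x = 1 ∨ ∃ A ∈ P.parts, leftEnd A = x := by
  simp [breakpoints]

lemma card_breakpoints (P : IntervalPartition) : P.breakpoints.card = P.parts.card + 1 := by
  rw [breakpoints, Finset.card_insert_of_notMem, Finset.card_image_of_injOn P.leftEnd_injOn]
  intro h
  obtain ⟨A, hA, hA'⟩ := Finset.mem_image.mp h
  exact (leftEnd_lt_one hA).ne hA'

lemma zero_mem_breakpoints (P : IntervalPartition) : (0 : ℝ) ∈ P.breakpoints := by
  obtain ⟨A, hA, h⟩ := P.cover 0
  exact mem_breakpoints.mpr (Or.inr ⟨A, hA, le_antisymm (leftEnd_le h) (leftEnd_nonneg hA)⟩)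

lemma breakpoints_nonneg {x : ℝ} (hx : x ∈ P.breakpoints) : 0 ≤ x := by
  rcases mem_breakpoints.mp hx with rfl | ⟨A, hA, rfl⟩
  exacts [zero_le_one, leftEnd_nonneg hA]

lemma breakpoints_le_one {x : ℝ} (hx : x ∈ P.breakpoints) : x ≤ 1 := by
  rcases mem_breakpoints.mp hx with rfl | ⟨A, hA, rfl⟩
  exacts [le_rfl, (leftEnd_lt_one hA).le]

/-- The `n`-th breakpoint `τ_n`, with `τ_n = 1` for `n ≥ m`. -/
noncomputable def tau (P : IntervalPartition) (n : ℕ) : ℝ := (P.breakpoints.sort (· ≤ ·)).getD n 1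

lemma length_sort_breakpoints (P : IntervalPartition) :
    (P.breakpoints.sort (· ≤ ·)).length = P.parts.card + 1 := by
  rw [Finset.length_sort, card_breakpoints]

lemma tau_mem (P : IntervalPartition) (n : ℕ) : P.tau n ∈ P.breakpoints := by
  unfold tau
  by_cases h : n < (P.breakpoints.sort (· ≤ ·)).length
  · rw [List.getD_eq_getElem _ _ h]
    exact (Finset.mem_sort (· ≤ ·)).mp (List.getElem_mem h)
  · rw [List.getD_eq_default _ _ (by omega)]
    exact mem_breakpoints.mpr (Or.inl rfl)

lemma tau_lt (P : IntervalPartition) {n n' : ℕ} (h : n < n') (h' : n' ≤ P.parts.card) :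
    P.tau n < P.tau n' := by
  have hl := P.length_sort_breakpoints
  unfold tau
  rw [List.getD_eq_getElem _ _ (by omega), List.getD_eq_getElem _ _ (by omega)]
  exact (Finset.sortedLT_sort P.breakpoints).strictMono_get (a := ⟨n, by omega⟩)
    (b := ⟨n', by omega⟩) h

lemma exists_tau_eq {x : ℝ} (hx : x ∈ P.breakpoints) : ∃ n ≤ P.parts.card, P.tau n = x := by
  obtain ⟨n, hn, h⟩ := List.getElem_of_mem ((Finset.mem_sort (· ≤ ·)).mpr hx)
  refine ⟨n, by have := P.length_sort_breakpoints; omega, ?_⟩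
  rw [tau, List.getD_eq_getElem _ _ hn, h]

lemma tau_eq_one (P : IntervalPartition) {n : ℕ} (h : P.parts.card ≤ n) : P.tau n = 1 := by
  rcases h.eq_or_lt with rfl | h
  · obtain ⟨n, hn, h⟩ := exists_tau_eq (mem_breakpoints (P := P).mpr (Or.inl rfl))
    rcases hn.eq_or_lt with rfl | hn
    · exact h
    · have h1 := P.tau_lt hn le_rfl
      have h2 := breakpoints_le_one (P.tau_mem P.parts.card)
      linarith
  · rw [tau, List.getD_eq_default _ _ (by have := P.length_sort_breakpoints; omega)]

lemma tau_zero (P : IntervalPartition) : P.tau 0 = 0 := by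
  obtain ⟨n, hn, h⟩ := exists_tau_eq P.zero_mem_breakpoints
  rcases Nat.eq_zero_or_pos n with rfl | h0
  · exact h
  · have h1 := P.tau_lt h0 hn
    have h2 := breakpoints_nonneg (P.tau_mem 0)
    linarith

lemma monotone_tau (P : IntervalPartition) : Monotone P.tau := by
  intro n n' h
  rcases h.eq_or_lt with rfl | h
  · exact le_rfl
  by_cases h' : n' ≤ P.parts.card
  · exact (P.tau_lt h h').le
  · rw [P.tau_eq_one (by omega : P.parts.card ≤ n')]
    exact breakpoints_le_one (P.tau_mem n)

lemma knot_eq_tau (P : IntervalPartition) (k i : ℕ) : P.knot k i = P.tau (i - (k - 1)) := rfl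

lemma knot_mem (P : IntervalPartition) (k i : ℕ) : P.knot k i ∈ P.breakpoints := P.tau_mem _

lemma knot_nonneg (P : IntervalPartition) (k i : ℕ) : 0 ≤ P.knot k i :=
  breakpoints_nonneg (P.knot_mem k i)

lemma knot_le_one (P : IntervalPartition) (k i : ℕ) : P.knot k i ≤ 1 :=
  breakpoints_le_one (P.knot_mem k i)

lemma monotone_knot (P : IntervalPartition) (k : ℕ) : Monotone (P.knot k) :=
  fun _ _ h => P.monotone_tau (Nat.sub_le_sub_right h _)

lemma knot_lt_succ {a : ℕ} (h1 : k - 1 ≤ a) (h2 : P.knot k a < 1) :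
    P.knot k a < P.knot k (a + 1) := by
  rw [knot_eq_tau] at *
  refine P.tau_lt (by omega) ?_
  by_contra! h
  rw [P.tau_eq_one (by omega)] at h2
  exact lt_irrefl _ h2

lemma index_bounds_of_knot_lt {a : ℕ} (h : P.knot k a < P.knot k (a + 1)) :
    k - 1 ≤ a ∧ a + 1 ≤ P.parts.card + (k - 1) := by
  rw [knot_eq_tau, knot_eq_tau] at h
  constructor
  · by_contra! h'
    rw [show a - (k - 1) = a + 1 - (k - 1) by omega] at h
    exact lt_irrefl _ h
  · by_contra! h'
    rw [P.tau_eq_one (by omega), P.tau_eq_one (by omega)] at h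
    exact lt_irrefl _ h

lemma knot_simple (P : IntervalPartition) (k i : ℕ) (h0 : 0 < P.knot k i)
    (h1 : P.knot k i < 1) : P.knot k i < P.knot k (i + 1) := by
  refine knot_lt_succ ?_ h1
  by_contra! h
  rw [knot_eq_tau, show i - (k - 1) = 0 by omega, tau_zero] at h0
  exact lt_irrefl _ h0

lemma knot_succ_le_of_lt {x : ℝ} (hx : x ∈ P.breakpoints) {i : ℕ} (h : P.knot k i < x) :
    P.knot k (i + 1) ≤ x := by
  obtain ⟨n, -, rfl⟩ := exists_tau_eq hx
  rw [knot_eq_tau] at *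
  refine P.monotone_tau ?_
  by_contra! h'
  exact absurd h (not_lt.mpr (P.monotone_tau (by omega)))

lemma exists_knot_eq {x : ℝ} (hx : x ∈ P.breakpoints) (k : ℕ) :
    ∃ a, k - 1 ≤ a ∧ P.knot k a = x := by
  obtain ⟨n, -, rfl⟩ := exists_tau_eq hx
  exact ⟨n + (k - 1), by omega, by rw [knot_eq_tau, Nat.add_sub_cancel]⟩

/-- `A` is the atom of the partition that lies between the knots `t_a < t_{a+1}` of order `k`. -/
structure IsAtom (P : IntervalPartition) (k a : ℕ) (A : Set unitInterval) : Prop where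
  mem_parts : A ∈ P.parts
  leftEnd_eq : leftEnd A = P.knot k a
  lt : P.knot k a < P.knot k (a + 1)

lemma exists_isAtom_of_mem_parts (hA : A ∈ P.parts) (k : ℕ) : ∃ a, P.IsAtom k a A := by
  obtain ⟨a, h1, h2⟩ := exists_knot_eq (mem_breakpoints.mpr (Or.inr ⟨A, hA, rfl⟩)) k
  exact ⟨a, hA, h2.symm, knot_lt_succ h1 (h2 ▸ leftEnd_lt_one hA)⟩

lemma exists_isAtom_mem (P : IntervalPartition) (k : ℕ) (x : unitInterval) :
    ∃ a A, P.IsAtom k a A ∧ x ∈ A := by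
  obtain ⟨A, hA, hx⟩ := P.cover x
  obtain ⟨a, ha⟩ := exists_isAtom_of_mem_parts hA k
  exact ⟨a, A, ha, hx⟩

lemma exists_isAtom_of_lt {a : ℕ} (h : P.knot k a < P.knot k (a + 1)) :
    ∃ A, P.IsAtom k a A := by
  rcases mem_breakpoints.mp (P.knot_mem k a) with h' | ⟨A, hA, hA'⟩
  · exact absurd (h' ▸ h) (not_lt.mpr (P.knot_le_one k _))
  · exact ⟨A, hA, hA', h⟩

lemma IsAtom.le {a : ℕ} (h : P.IsAtom k a A) {x : unitInterval} (hx : x ∈ A) :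
    P.knot k a ≤ x := h.leftEnd_eq ▸ leftEnd_le hx

lemma IsAtom.le_succ {a : ℕ} (h : P.IsAtom k a A) {x : unitInterval} (hx : x ∈ A) :
    (x : ℝ) ≤ P.knot k (a + 1) := by
  by_contra! h'
  rcases mem_breakpoints.mp (P.knot_mem k (a + 1)) with h1 | ⟨B, hB, hB'⟩
  · exact absurd x.2.2 (not_le.mpr (h1 ▸ h'))
  · have := eq_of_leftEnd_le hB h.mem_parts hx (by rw [hB', h.leftEnd_eq]; exact h.lt.le)
      (hB' ▸ h')
    rw [← this] at h
    exact h.lt.ne' (hB'.symm.trans h.leftEnd_eq)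

lemma IsAtom.mem {a : ℕ} (h : P.IsAtom k a A) {x : unitInterval} (h1 : P.knot k a < x)
    (h2 : (x : ℝ) < P.knot k (a + 1)) : x ∈ A := by
  obtain ⟨B, hB, hx⟩ := P.cover x
  have h3 : leftEnd B ≤ leftEnd A := by
    by_contra! h'
    rw [h.leftEnd_eq] at h'
    have := knot_succ_le_of_lt (mem_breakpoints.mpr (Or.inr ⟨B, hB, rfl⟩)) h'
    linarith [leftEnd_le hx]
  rwa [eq_of_leftEnd_le h.mem_parts hB hx h3 (h.leftEnd_eq ▸ h1)]

lemma IsAtom.coxDeBoor_eq {a : ℕ} (h : P.IsAtom k a A) {x : unitInterval} (hx : x ∈ A)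
    (d i : ℕ) :
    P.coxDeBoor (P.knot k) d i x = blossom (P.knot k) a d i (List.replicate d (x : ℝ)) := by
  induction d generalizing i with
  | zero =>
    classical
    rw [coxDeBoor, blossom, Set.indicator_apply]
    refine if_congr ?_ rfl rfl
    constructor
    · rintro ⟨h1, B, hB, hxB, hB'⟩
      rw [eq_of_mem_of_mem hB h.mem_parts hxB hx, h.leftEnd_eq] at hB'
      have hm := P.monotone_knot k
      rcases lt_trichotomy i a with h2 | h2 | h2
      · have := hm (show i + 1 ≤ a by omega)
        linarith
      · exact h2
      · have := hm (show a + 1 ≤ i by omega)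
        linarith [h.lt]
    · rintro rfl
      exact ⟨h.lt, A, h.mem_parts, hx, h.leftEnd_eq⟩
  | succ d ih =>
    rw [coxDeBoor, List.replicate_succ, blossom]
    simp only [ih]

lemma IsAtom.bspline_eq {a : ℕ} (h : P.IsAtom k a A) {x : unitInterval} (hx : x ∈ A) (i : ℕ) :
    P.bspline k i x = blossom (P.knot k) a (k - 1) i (List.replicate (k - 1) (x : ℝ)) :=
  h.coxDeBoor_eq hx _ _

lemma bspline_nonneg (P : IntervalPartition) (k i : ℕ) (x : unitInterval) :
    0 ≤ P.bspline k i x := by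
  obtain ⟨a, A, h, hx⟩ := P.exists_isAtom_mem k x
  rw [h.bspline_eq hx]
  exact blossom_replicate_nonneg (P.monotone_knot k) (h.le hx) (h.le_succ hx) _ _

lemma IsAtom.index_bounds {a : ℕ} (h : P.IsAtom k a A) :
    k - 1 ≤ a ∧ a < P.parts.card + (k - 1) := index_bounds_of_knot_lt h.lt

lemma IsAtom.sum_window_mul_bspline {a : ℕ} (h : P.IsAtom k a A) {x : unitInterval} (hx : x ∈ A)
    {B : List ℝ → ℝ} (hB : IsPolarForm (k - 1) B) :
    ∑ j ∈ Finset.range (P.parts.card + (k - 1)),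
      B (window (P.knot k) j (k - 1)) * P.bspline k j x = B (List.replicate (k - 1) (x : ℝ)) := by
  rw [← sum_window_mul_blossom (P.monotone_knot k) h.lt h.index_bounds.1 h.index_bounds.2 hB
    (List.length_replicate ..)]
  exact Finset.sum_congr rfl fun j _ => by rw [h.bspline_eq hx]

lemma sum_bspline (P : IntervalPartition) (k : ℕ) (x : unitInterval) :
    ∑ j ∈ Finset.range (P.parts.card + (k - 1)), P.bspline k j x = 1 := by
  obtain ⟨a, A, h, hx⟩ := P.exists_isAtom_mem k x
  simpa using h.sum_window_mul_bspline hx (isPolarForm_one _)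

lemma mem_Icc_of_bspline_ne_zero (hk : 1 ≤ k) {i : ℕ} {x : unitInterval}
    (h : P.bspline k i x ≠ 0) : (x : ℝ) ∈ Set.Icc (P.knot k i) (P.knot k (i + k)) := by
  obtain ⟨a, A, hA, hx⟩ := P.exists_isAtom_mem k x
  rw [hA.bspline_eq hx] at h
  obtain ⟨h1, h2⟩ := index_bounds_of_blossom_ne_zero h
  exact ⟨(P.monotone_knot k h1).trans (hA.le hx),
    (hA.le_succ hx).trans (P.monotone_knot k (by omega))⟩

/-! ### Refinement -/

/-- Each atom of a finer interval σ-algebra lies in an atom of the coarser one. -/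
lemma exists_subset_of_le (hPQ : P.sigmaAlgebra ≤ Q.sigmaAlgebra) (hB : B ∈ Q.parts) :
    ∃ A ∈ P.parts, B ⊆ A := by
  have key : ∀ S, MeasurableSet[Q.sigmaAlgebra] S → B ⊆ S ∨ Disjoint B S := by
    intro S hS
    induction S, hS using MeasurableSpace.generateFrom_induction with
    | hC S hS _ =>
      by_cases h : B = S
      · exact Or.inl h.le
      · exact Or.inr (Q.disjoint hB hS h)
    | empty => exact Or.inr (Set.disjoint_empty _)
    | compl S _ ih =>
      rcases ih with h | h
      · exact Or.inr (Set.disjoint_compl_right_iff_subset.mpr h)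
      · exact Or.inl h.subset_compl_right
    | iUnion S _ ih =>
      by_cases h : ∃ n, B ⊆ S n
      · obtain ⟨n, hn⟩ := h
        exact Or.inl (hn.trans (Set.subset_iUnion S n))
      · push Not at h
        exact Or.inr (Set.disjoint_iUnion_right.mpr fun n => (ih n).resolve_left (h n))
  obtain ⟨x, hx⟩ := nonempty_of_mem_parts hB
  obtain ⟨A, hA, hxA⟩ := P.cover x
  refine ⟨A, hA, (key A (hPQ _ (MeasurableSpace.measurableSet_generateFrom hA))).resolve_right ?_⟩
  exact fun h => Set.disjoint_left.mp h hx hxA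

lemma breakpoints_subset (hPQ : P.sigmaAlgebra ≤ Q.sigmaAlgebra) :
    P.breakpoints ⊆ Q.breakpoints := by
  intro τ hτ
  rcases mem_breakpoints.mp hτ with rfl | ⟨A, hA, rfl⟩
  · exact mem_breakpoints.mpr (Or.inl rfl)
  -- A point of `A` near its left end lies in an atom of `Q` that starts at the same point.
  by_contra hnot
  obtain ⟨y, hy, hy'⟩ := exists_mem_leftEnd_lt hA
  let x : unitInterval := ⟨leftEnd A, leftEnd_nonneg hA, (leftEnd_lt_one hA).le⟩
  obtain ⟨b, B, hB, hxB⟩ := Q.exists_isAtom_mem 1 x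
  have h1 : Q.knot 1 b < leftEnd A :=
    lt_of_le_of_ne (hB.le hxB) fun h => hnot (h ▸ Q.knot_mem 1 b)
  have h2 : leftEnd A < Q.knot 1 (b + 1) :=
    lt_of_le_of_ne (hB.le_succ hxB) fun h => hnot (h.symm ▸ Q.knot_mem 1 (b + 1))
  obtain ⟨z, hz1, hz2⟩ := exists_between (lt_min hy' h2)
  let w : unitInterval := ⟨z, (leftEnd_nonneg hA).trans hz1.le,
    (hz2.le.trans (min_le_left _ _)).trans y.2.2⟩
  have hwA : w ∈ A := mem_of_leftEnd_lt hA hy hz1 (hz2.le.trans (min_le_left _ _))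
  have hwB : w ∈ B := hB.mem (h1.trans hz1) (hz2.trans_le (min_le_right _ _))
  obtain ⟨u, hu1, hu2⟩ := exists_between h1
  let v : unitInterval := ⟨u, (Q.knot_nonneg 1 b).trans hu1.le,
    hu2.le.trans (leftEnd_lt_one hA).le⟩
  have hvB : v ∈ B := hB.mem hu1 (hu2.trans h2)
  obtain ⟨A', hA', hBA'⟩ := exists_subset_of_le hPQ hB.mem_parts
  have hvA : v ∈ A := eq_of_mem_of_mem hA' hA (hBA' hwB) hwA ▸ hBA' hvB
  exact absurd (leftEnd_le hvA) (not_le.mpr hu2)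

lemma IsSpline.refine {f : unitInterval → ℝ} (hf : P.IsSpline k f)
    (hPQ : P.sigmaAlgebra ≤ Q.sigmaAlgebra) : Q.IsSpline k f := by
  refine ⟨hf.1, fun B hB => ?_⟩
  obtain ⟨A, hA, hBA⟩ := exists_subset_of_le hPQ hB
  obtain ⟨p, hp, h⟩ := hf.2 A hA
  exact ⟨p, hp, fun x hx => h x (hBA hx)⟩

/-- If the coefficients of a spline for the finer partition dominate those for the coarser one on
all nested pairs of B-spline supports, then the former spline dominates the latter. -/
theorem sum_mul_bspline_le_of_refine (hPQ : P.sigmaAlgebra ≤ Q.sigmaAlgebra) (hk : 1 ≤ k)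
    {u v : ℕ → ℝ} (huv : ∀ i < P.parts.card + (k - 1), ∀ j < Q.parts.card + (k - 1),
      P.knot k i ≤ Q.knot k j → Q.knot k (j + k) ≤ P.knot k (i + k) → u i ≤ v j)
    (x : unitInterval) :
    ∑ i ∈ Finset.range (P.parts.card + (k - 1)), u i * P.bspline k i x ≤
      ∑ j ∈ Finset.range (Q.parts.card + (k - 1)), v j * Q.bspline k j x := by
  obtain ⟨b, B, hB, hx⟩ := Q.exists_isAtom_mem k x
  obtain ⟨A, hA', hBA⟩ := exists_subset_of_le hPQ hB.mem_parts
  obtain ⟨a, hA⟩ := exists_isAtom_of_mem_parts hA' k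
  have hab : P.knot k a ≤ Q.knot k b := by
    rw [← hB.leftEnd_eq]
    refine le_csInf ((nonempty_of_mem_parts hB.mem_parts).image _) ?_
    rintro _ ⟨y, hy, rfl⟩
    exact hA.le (hBA hy)
  have hba : Q.knot k (b + 1) ≤ P.knot k (a + 1) := by
    refine le_of_forall_lt fun c hc => ?_
    obtain ⟨z, hz1, hz2⟩ := exists_between (max_lt hc hB.lt)
    have hz3 := (le_max_right _ _).trans_lt hz1
    let w : unitInterval := ⟨z, (Q.knot_nonneg k b).trans hz3.le,
      hz2.le.trans (Q.knot_le_one k _)⟩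
    exact ((le_max_left _ _).trans_lt hz1).trans_le
      (hA.le_succ (x := w) (hBA (hB.mem hz3 hz2)))
  set d := k - 1 with hd
  set β : ℕ → ℕ → ℝ := fun i j => blossom (P.knot k) a d i (window (Q.knot k) j d) with hβ
  have hbd := hB.index_bounds
  have hexp : ∀ i, P.bspline k i x =
      ∑ j ∈ Finset.range (Q.parts.card + d), β i j * Q.bspline k j x := fun i => by
    rw [hA.bspline_eq (hBA hx), ← hB.sum_window_mul_bspline hx
      (isPolarForm_blossom (P.monotone_knot k) a _ i)]
  have hsum : ∀ j, ∑ i ∈ Finset.range (P.parts.card + d), β i j = 1 := fun j => by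
    have := sum_window_mul_blossom (P.monotone_knot k) hA.lt hA.index_bounds.1 hA.index_bounds.2
      (isPolarForm_one _) (length_window (Q.knot k) j d)
    simpa using this
  calc ∑ i ∈ Finset.range (P.parts.card + d), u i * P.bspline k i x
      = ∑ j ∈ Finset.range (Q.parts.card + d),
          (∑ i ∈ Finset.range (P.parts.card + d), β i j * u i) * Q.bspline k j x := by
        simp only [hexp, Finset.mul_sum, Finset.sum_mul]
        rw [Finset.sum_comm]
        refine Finset.sum_congr rfl fun j _ => Finset.sum_congr rfl fun i _ => by ring
    _ ≤ ∑ j ∈ Finset.range (Q.parts.card + d), v j * Q.bspline k j x := by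
        refine Finset.sum_le_sum fun j hj => ?_
        by_cases h0 : Q.bspline k j x = 0
        · simp [h0]
        refine mul_le_mul_of_nonneg_right ?_ (Q.bspline_nonneg k j x)
        have h0' := h0
        rw [hB.bspline_eq hx] at h0'
        obtain ⟨h1, h2⟩ := index_bounds_of_blossom_ne_zero h0'
        calc ∑ i ∈ Finset.range (P.parts.card + d), β i j * u i
            ≤ ∑ i ∈ Finset.range (P.parts.card + d), β i j * v j := by
              refine Finset.sum_le_sum fun i hi => ?_
              obtain ⟨h3, h4⟩ := blossom_window_nonneg (P.monotone_knot k) (Q.monotone_knot k)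
                (P.knot_simple k) (Q.knot_nonneg k) (Q.knot_le_one k)
                (fun i j h => knot_succ_le_of_lt (breakpoints_subset hPQ (P.knot_mem k i)) h)
                hB.lt hab hba h1 h2 i
              by_cases h5 : β i j = 0
              · simp [h5]
              obtain ⟨h6, h7⟩ := h4 h5
              refine mul_le_mul_of_nonneg_left (huv i (Finset.mem_range.mp hi) j
                (Finset.mem_range.mp hj) h6 ?_) h3
              rwa [show j + k = j + (k - 1) + 1 by omega, show i + k = i + (k - 1) + 1 by omega]
          _ = v j := by rw [← Finset.sum_mul, hsum, one_mul]

end IntervalPartition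

/-! ### Smoothness across the knots -/

namespace BSpline

open Polynomial

variable {t : ℕ → ℝ} {a : ℕ}

lemma exists_polynomial_blossom (t : ℕ → ℝ) (a d i : ℕ) :
    ∃ p : ℝ[X], p.degree < ((d + 1 : ℕ) : WithBot ℕ) ∧
      ∀ x, p.eval x = blossom t a d i (List.replicate d x) := by
  simp only [Nat.cast_add, Nat.cast_one]
  suffices h : ∃ p : ℝ[X], p.natDegree ≤ d ∧
      ∀ x, p.eval x = blossom t a d i (List.replicate d x) by
    obtain ⟨p, hp, h⟩ := h
    exact ⟨p, (degree_le_of_natDegree_le hp).trans_lt (by exact_mod_cast Nat.lt_succ_self d), h⟩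
  induction d generalizing i with
  | zero =>
    refine ⟨C (if i = a then 1 else 0), (natDegree_C _).le, fun x => ?_⟩
    rw [eval_C, blossom]
  | succ d ih =>
    obtain ⟨p, hp, h⟩ := ih i
    obtain ⟨q, hq, h'⟩ := ih (i + 1)
    refine ⟨C (t (i + d + 1) - t i)⁻¹ * ((X - C (t i)) * p) +
      C (t (i + d + 2) - t (i + 1))⁻¹ * ((C (t (i + d + 2)) - X) * q), ?_, fun x => ?_⟩
    · refine natDegree_add_le_of_degree_le ?_ ?_
      · refine (natDegree_C_mul_le _ _).trans (natDegree_mul_le.trans ?_)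
        have := natDegree_X_sub_C_le (t i)
        omega
      · refine (natDegree_C_mul_le _ _).trans (natDegree_mul_le.trans ?_)
        have : (C (t (i + d + 2)) - X : ℝ[X]).natDegree ≤ 1 := by
          rw [← neg_sub, natDegree_neg]
          exact natDegree_X_sub_C_le _
        omega
    · simp only [eval_add, eval_mul, eval_C, eval_sub, eval_X, h, h', List.replicate_succ, blossom]
      ring

/-- The polynomial pieces of a B-spline of degree `d` on adjacent knot intervals differ by a
multiple of `(x - τ) ^ d`, where `τ` is the common knot.  Indeed, all but one of the functionals
dual to the B-splines on the first interval vanish at the difference and at `(x - τ) ^ d`. -/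
lemma blossom_sub_blossom (ht : Monotone t) {d : ℕ} (hd : d ≤ a) (h1 : t a < t (a + 1))
    (h2 : t (a + 1) < t (a + 1 + 1)) (i : ℕ) :
    ∃ c, ∀ x, blossom t a d i (List.replicate d x) - blossom t (a + 1) d i (List.replicate d x) =
      c * (x - t (a + 1)) ^ d := by
  set W := window t (a - d) d
  set r := (W.map (· - t (a + 1))).prod with hr
  have hr0 : r ≠ 0 := by
    refine List.prod_ne_zero fun h => ?_
    obtain ⟨y, hy, hy0⟩ := List.mem_map.mp h
    obtain ⟨l, -, hl, rfl⟩ := mem_window.mp hy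
    have := ht (show l ≤ a by omega)
    linarith
  refine ⟨(blossom t a d i W - blossom t (a + 1) d i W) / r, fun x => ?_⟩
  have hB := (isPolarForm_blossom ht a d i).sub_sub_mul (isPolarForm_blossom ht (a + 1) d i)
    (isPolarForm_prod d (t (a + 1))) ((blossom t a d i W - blossom t (a + 1) d i W) / r)
  have key := sum_window_mul_blossom ht h1 hd (Nat.lt_succ_self a) hB
    (List.length_replicate (n := d) (a := x))
  rw [Finset.sum_eq_zero] at key
  · rw [List.map_replicate, List.prod_replicate] at key
    linarith
  · intro j hj
    by_cases h0 : blossom t a d j (List.replicate d x) = 0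
    · rw [h0, mul_zero]
    obtain ⟨h3, h4⟩ := index_bounds_of_blossom_ne_zero h0
    rcases eq_or_ne j (a - d) with rfl | hj'
    · rw [div_mul_cancel₀ _ hr0, sub_self, zero_mul]
    · have hz : ((window t j d).map (· - t (a + 1))).prod = 0 := by
        refine List.prod_eq_zero (List.mem_map.mpr ⟨t (a + 1), ?_, sub_self _⟩)
        exact mem_window.mpr ⟨a + 1, by omega, by omega, rfl⟩
      rw [hz, blossom_window ht h1 h3 h4, blossom_window ht h2 (by omega) (by omega)]
      ring

lemma contDiff_max_pow (d : ℕ) (τ : ℝ) :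
    ContDiff ℝ (d : WithTop ℕ∞) (fun x : ℝ => max (x - τ) 0 ^ (d + 1)) := by
  induction d with
  | zero =>
    rw [Nat.cast_zero, contDiff_zero]
    fun_prop
  | succ d ih =>
    have hd : ∀ x, HasDerivAt (fun x : ℝ => max (x - τ) 0 ^ (d + 1 + 1))
        (((d + 1 + 1 : ℕ) : ℝ) * max (x - τ) 0 ^ (d + 1)) x := by
      intro x
      have hne : ∀ y, y ≠ τ → HasDerivAt (fun x : ℝ => max (x - τ) 0 ^ (d + 1 + 1))
          (((d + 1 + 1 : ℕ) : ℝ) * max (y - τ) 0 ^ (d + 1)) y := by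
        intro y hy
        rcases lt_or_gt_of_ne hy with h | h
        · rw [max_eq_right (by linarith), zero_pow (by omega), mul_zero]
          refine (hasDerivAt_const y (0 : ℝ)).congr_of_eventuallyEq ?_
          filter_upwards [gt_mem_nhds h] with z hz
          rw [max_eq_right (by linarith), zero_pow (by omega)]
        · rw [max_eq_left (by linarith)]
          have := ((hasDerivAt_id y).sub_const τ).pow (d + 1 + 1)
          simp only [id, mul_one, Nat.add_sub_cancel] at this
          refine this.congr_of_eventuallyEq ?_
          filter_upwards [lt_mem_nhds h] with z hz
          rw [max_eq_left (by linarith)]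
          rfl
      rcases eq_or_ne x τ with rfl | hx
      · exact hasDerivAt_of_hasDerivAt_of_ne (f := fun z : ℝ => max (z - x) 0 ^ (d + 1 + 1))
          (g := fun y => ((d + 1 + 1 : ℕ) : ℝ) * max (y - x) 0 ^ (d + 1)) (x := x) hne
          (by fun_prop) (by fun_prop)
      · exact hne x hx
    rw [Nat.cast_add, Nat.cast_one, contDiff_succ_iff_deriv]
    refine ⟨fun x => (hd x).differentiableAt, by simp, ?_⟩
    rw [show deriv (fun x : ℝ => max (x - τ) 0 ^ (d + 1 + 1)) = fun x =>
      ((d + 1 + 1 : ℕ) : ℝ) * max (x - τ) 0 ^ (d + 1) from funext fun x => (hd x).deriv]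
    exact contDiff_const.mul ih

/-- Where two polynomials meet to form a function of class `C^n`, their derivatives up to order `n`
agree. -/
lemma eval_iterate_derivative_eq {n : ℕ} {u τ v : ℝ} (hu : u < τ) (hv : τ < v) {F : ℝ → ℝ}
    (hF : ContDiffOn ℝ (n : WithTop ℕ∞) F (Set.Ioo u v)) {p q : ℝ[X]}
    (hp : ∀ x ∈ Set.Ioo u τ, F x = p.eval x) (hq : ∀ x ∈ Set.Ioo τ v, F x = q.eval x)
    {r : ℕ} (hr : r ≤ n) : (derivative^[r] p).eval τ = (derivative^[r] q).eval τ := by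
  induction r generalizing n F p q with
  | zero =>
    have hc : ContinuousAt F τ :=
      hF.continuousOn.continuousAt (Ioo_mem_nhds hu hv)
    have h1 : F τ = p.eval τ := by
      refine tendsto_nhds_unique_of_eventuallyEq (l := nhdsWithin τ (Set.Iio τ))
        (hc.mono_left nhdsWithin_le_nhds) (p.continuous.continuousAt.mono_left
          nhdsWithin_le_nhds) ?_
      filter_upwards [Ioo_mem_nhdsLT hu] with x hx using hp x hx
    have h2 : F τ = q.eval τ := by
      refine tendsto_nhds_unique_of_eventuallyEq (l := nhdsWithin τ (Set.Ioi τ))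
        (hc.mono_left nhdsWithin_le_nhds) (q.continuous.continuousAt.mono_left
          nhdsWithin_le_nhds) ?_
      filter_upwards [Ioo_mem_nhdsGT hv] with x hx using hq x hx
    exact h1.symm.trans h2
  | succ r ih =>
    obtain ⟨n, rfl⟩ : ∃ m, n = m + 1 := ⟨n - 1, by omega⟩
    rw [Function.iterate_succ_apply, Function.iterate_succ_apply]
    refine ih (n := n) (F := deriv F) (hF.deriv_of_isOpen isOpen_Ioo (by push_cast; rfl)) ?_ ?_
      (by omega)
    · intro x hx
      rw [← p.deriv]
      refine Filter.EventuallyEq.deriv_eq ?_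
      filter_upwards [isOpen_Ioo.mem_nhds hx] with y hy using hp y hy
    · intro x hx
      rw [← q.deriv]
      refine Filter.EventuallyEq.deriv_eq ?_
      filter_upwards [isOpen_Ioo.mem_nhds hx] with y hy using hq y hy

lemma eq_C_mul_X_sub_C_pow {d : ℕ} {τ : ℝ} {p : ℝ[X]} (hp : p.natDegree ≤ d)
    (h : ∀ r < d, (derivative^[r] p).eval τ = 0) : ∃ c, p = C c * (X - C τ) ^ d := by
  refine ⟨(taylor τ p).coeff d, taylor_injective τ ?_⟩
  rw [taylor_mul, taylor_C, taylor_pow, map_sub, taylor_X, taylor_C, add_sub_cancel_right]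
  ext r
  rw [coeff_C_mul, coeff_X_pow]
  rcases lt_trichotomy r d with hr | rfl | hr
  · rw [if_neg hr.ne, mul_zero, taylor_coeff]
    have h1 := congrArg (eval τ) (congrFun (factorial_smul_hasseDeriv (R := ℝ) r) p)
    rw [h r hr, LinearMap.smul_apply, eval_smul, nsmul_eq_mul] at h1
    exact (mul_eq_zero.mp h1).resolve_left (by exact_mod_cast r.factorial_ne_zero)
  · rw [if_pos rfl, mul_one]
  · rw [if_neg hr.ne', mul_zero]
    exact coeff_eq_zero_of_natDegree_lt (by rw [natDegree_taylor]; omega)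

end BSpline

namespace IntervalPartition

open BSpline Polynomial

variable {P : IntervalPartition} {A : Set unitInterval} {k : ℕ}

/-- Polynomial pieces of degree `k - 1` that differ by a multiple of `(x - τ) ^ (k - 1)` at each
inner knot `τ` form a spline, as the jumps are absorbed by truncated powers. -/
lemma isSpline_of_pieces {f : unitInterval → ℝ} {p : ℕ → ℝ[X]}
    (hp : ∀ a, (p a).degree < (k : WithBot ℕ))
    (hf : ∀ a A, P.IsAtom k a A → ∀ x ∈ A, f x = (p a).eval (x : ℝ))
    (hstep : ∀ a, P.knot k a < P.knot k (a + 1) → P.knot k (a + 1) < P.knot k (a + 1 + 1) →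
      ∃ c, ∀ x, (p (a + 1)).eval x - (p a).eval x = c * (x - P.knot k (a + 1)) ^ (k - 1)) :
    P.IsSpline k f := by
  refine ⟨fun hk2 => ?_, fun A hA => ?_⟩
  swap
  · obtain ⟨a, ha⟩ := exists_isAtom_of_mem_parts hA k
    exact ⟨p a, hp a, hf a A ha⟩
  choose! c hc using hstep
  set d := k - 1 with hd
  set m := P.parts.card
  have hcd : ContDiff ℝ ((k - 2 : ℕ) : WithTop ℕ∞) (fun x : ℝ => (p d).eval x +
      ∑ n ∈ Finset.range (m - 1), c (d + n) * max (x - P.knot k (d + n + 1)) 0 ^ d) := by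
    have hpd : ContDiff ℝ ((k - 2 : ℕ) : WithTop ℕ∞) (fun x : ℝ => (p d).eval x) := by
      simpa using (p d).contDiff_aeval (𝕜 := ℝ) ((k - 2 : ℕ) : WithTop ℕ∞)
    refine hpd.add (ContDiff.sum fun n _ => contDiff_const.mul ?_)
    rw [show d = k - 2 + 1 by omega]
    exact contDiff_max_pow _ _
  refine hcd.contDiffOn.congr fun x hx => ?_
  rw [Set.IccExtend_of_mem _ _ hx]
  obtain ⟨a, A, hA, hxA⟩ := P.exists_isAtom_mem k ⟨x, hx⟩
  rw [hf a A hA _ hxA]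
  have hx1 := hA.le hxA
  have hx2 := hA.le_succ hxA
  have hmono := P.monotone_knot k
  obtain ⟨h1, h2⟩ := hA.index_bounds
  obtain ⟨N, rfl⟩ : ∃ N, a = d + N := ⟨a - d, by omega⟩
  have htel : ∀ n ≤ N, (p (d + n)).eval x = (p d).eval x +
      ∑ n' ∈ Finset.range n, c (d + n') * (x - P.knot k (d + n' + 1)) ^ d := by
    intro n hn
    induction n with
    | zero => simp
    | succ n ih =>
      have hn' : P.knot k (d + n + 1) < P.knot k (d + n + 1 + 1) := by
        refine knot_lt_succ (by omega) (lt_of_le_of_lt (hmono (show _ ≤ d + N by omega)) ?_)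
        exact hA.lt.trans_le (P.knot_le_one k _)
      have := hc (d + n) (knot_lt_succ (by omega) ((hmono (Nat.le_succ _)).trans_lt
        (hn'.trans_le (P.knot_le_one k _)))) hn' x
      rw [Finset.sum_range_succ, ← add_assoc ((p d).eval x), ← ih (by omega), ← this]
      ring_nf
  change (p (d + N)).eval x = _
  rw [htel N le_rfl]
  congr 1
  have hsub : Finset.range N ⊆ Finset.range (m - 1) := Finset.range_subset_range.mpr (by omega)
  rw [← Finset.sum_subset hsub]
  · refine Finset.sum_congr rfl fun n hn => ?_
    have hn' := hmono (show d + n + 1 ≤ d + N by have := Finset.mem_range.mp hn; omega)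
    rw [max_eq_left]
    change P.knot k (d + N) ≤ x at hx1
    linarith
  · intro n _ hn
    have hn' := hmono (show d + N + 1 ≤ d + n + 1 by
      have := Finset.mem_range.not.mp hn; omega)
    change x ≤ P.knot k (d + N + 1) at hx2
    rw [max_eq_right (by linarith), zero_pow (by omega), mul_zero]

lemma isSpline_bspline (hk : 1 ≤ k) (i : ℕ) : P.IsSpline k (P.bspline k i) := by
  choose p hp hp' using fun a => exists_polynomial_blossom (P.knot k) a (k - 1) i
  refine isSpline_of_pieces (p := p) (fun a => ?_) (fun a A hA x hx => ?_) (fun a h1 h2 => ?_)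
  · have := hp a
    rwa [Nat.sub_add_cancel hk] at this
  · rw [hA.bspline_eq hx, hp']
  · obtain ⟨c, hc⟩ := blossom_sub_blossom (P.monotone_knot k) (index_bounds_of_knot_lt h1).1 h1 h2 i
    refine ⟨-c, fun x => ?_⟩
    rw [hp', hp', neg_mul, ← hc x, neg_sub]

lemma IsSpline.sum_mul {ι : Type*} (s : Finset ι) (u : ι → ℝ) {f : ι → unitInterval → ℝ}
    (hf : ∀ i ∈ s, P.IsSpline k (f i)) : P.IsSpline k (fun x => ∑ i ∈ s, u i * f i x) := by
  refine ⟨fun hk => ?_, fun A hA => ?_⟩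
  · exact ContDiffOn.sum (f := fun i => fun x => u i * Set.IccExtend zero_le_one (f i) x)
      fun i hi => contDiffOn_const.mul ((hf i hi).1 hk)
  · choose! p hp hp' using fun i hi => (hf i hi).2 A hA
    refine ⟨∑ i ∈ s, C (u i) * p i, ?_, fun x hx => ?_⟩
    · refine mem_degreeLT.mp (Submodule.sum_mem _ fun i hi => ?_)
      rw [← smul_eq_C_mul]
      exact Submodule.smul_mem _ _ (mem_degreeLT.mpr (hp i hi))
    · rw [eval_finsetSum]
      refine Finset.sum_congr rfl fun i hi => ?_
      rw [eval_mul, eval_C, hp' i hi x hx]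

/-- The polynomial pieces of a spline on adjacent atoms differ by a multiple of
`(x - τ) ^ (k - 1)`. -/
lemma IsSpline.sub_eq {f : unitInterval → ℝ} (hf : P.IsSpline k f) {p q : ℝ[X]} {a : ℕ}
    {A A' : Set unitInterval} (hk : 1 ≤ k) (hA : P.IsAtom k a A) (hA' : P.IsAtom k (a + 1) A')
    (hp : p.degree < (k : WithBot ℕ)) (hq : q.degree < (k : WithBot ℕ))
    (hfp : ∀ x ∈ A, f x = p.eval (x : ℝ)) (hfq : ∀ x ∈ A', f x = q.eval (x : ℝ)) :
    ∃ c, p - q = C c * (X - C (P.knot k (a + 1))) ^ (k - 1) := by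
  refine eq_C_mul_X_sub_C_pow ?_ fun r hr => ?_
  · have h := (degree_sub_le p q).trans_lt (max_lt hp hq)
    by_cases h0 : p - q = 0
    · simp [h0]
    · have := (natDegree_lt_iff_degree_lt h0).mpr h
      omega
  · rw [iterate_derivative_sub, eval_sub, sub_eq_zero]
    have h01 : Set.Ioo (P.knot k a) (P.knot k (a + 1 + 1)) ⊆ Set.Icc 0 1 := fun x hx =>
      ⟨(P.knot_nonneg k a).trans hx.1.le, hx.2.le.trans (P.knot_le_one k _)⟩
    refine eval_iterate_derivative_eq hA.lt hA'.lt ((hf.1 (by omega)).mono h01) ?_ ?_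
      (show r ≤ k - 2 by omega)
    · intro x hx
      have hx' := h01 ⟨hx.1, hx.2.trans hA'.lt⟩
      rw [Set.IccExtend_of_mem _ _ hx']
      exact hfp ⟨x, hx'⟩ (hA.mem hx.1 hx.2)
    · intro x hx
      have hx' := h01 ⟨hA.lt.trans hx.1, hx.2⟩
      rw [Set.IccExtend_of_mem _ _ hx']
      exact hfq ⟨x, hx'⟩ (hA'.mem hx.1 hx.2)

end IntervalPartition

/-! ### The dual functionals -/

namespace BSpline

open Polynomial

/-- The `d`-th powers of linear polynomials span the polynomials of degree at most `d`, since the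
Vandermonde matrix is invertible. -/
lemma exists_eq_sum_X_sub_C_pow {d : ℕ} {p : ℝ[X]} (hp : p.natDegree ≤ d) :
    ∃ w c : Fin (d + 1) → ℝ, p = ∑ m, C (w m) * (X - C (c m)) ^ d := by
  set v : Fin (d + 1) → ℝ := fun m => (m : ℝ)
  have hv : IsUnit (Matrix.vandermonde v) := by
    rw [Matrix.isUnit_iff_isUnit_det, isUnit_iff_ne_zero]
    exact Matrix.det_vandermonde_ne_zero_iff.mpr fun i j h => Fin.ext (Nat.cast_injective h)
  obtain ⟨w, hw⟩ := Matrix.vecMul_surjective_iff_isUnit.mpr hv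
    (fun e : Fin (d + 1) => p.coeff (d - e) / (d.choose e : ℝ))
  refine ⟨w, fun m => -v m, ?_⟩
  ext r
  simp only [finsetSum_coeff, coeff_C_mul, C_neg, sub_neg_eq_add, coeff_X_add_C_pow]
  by_cases hr : r ≤ d
  · have h := congrFun hw ⟨d - r, by omega⟩
    simp only [Matrix.vecMul, dotProduct, Matrix.vandermonde_apply] at h
    rw [Nat.sub_sub_self hr, Nat.choose_symm hr, eq_div_iff
      (by exact_mod_cast (Nat.choose_pos hr).ne'), Finset.sum_mul] at h
    rw [← h]
    exact Finset.sum_congr rfl fun m _ => by ring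
  · rw [coeff_eq_zero_of_natDegree_lt (by omega), Nat.choose_eq_zero_of_lt (by omega)]
    simp

/-- The linear functional that takes a polynomial of degree at most `d` to the value of its polar
form at a list `W` of `d` arguments.  It is written with the Taylor coefficients at `u`, and on
polynomials of degree at most `d` it does not depend on `u`. -/
noncomputable def dualFunctional (d : ℕ) (W : List ℝ) (u : ℝ) : ℝ[X] →ₗ[ℝ] ℝ :=
  ∑ r ∈ Finset.range (d + 1),
    ((W.map fun s => X + C (s - u)).prod.coeff (d - r) / (d.choose r : ℝ)) •
      (lcoeff ℝ r ∘ₗ taylor u)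

lemma dualFunctional_apply (d : ℕ) (W : List ℝ) (u : ℝ) (p : ℝ[X]) :
    dualFunctional d W u p = ∑ r ∈ Finset.range (d + 1),
      (W.map fun s => X + C (s - u)).prod.coeff (d - r) / (d.choose r : ℝ) *
        (taylor u p).coeff r := by
  simp [dualFunctional]

lemma natDegree_prod_X_add_C_le (L : List ℝ) (u : ℝ) :
    (L.map fun s => (X + C (s - u) : ℝ[X])).prod.natDegree ≤ L.length := by
  induction L with
  | nil => simp
  | cons s L ih =>
    rw [List.map_cons, List.prod_cons, List.length_cons]
    exact natDegree_mul_le.trans ((add_le_add (natDegree_X_add_C (s - u)).le ih).trans_eq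
      (add_comm _ _))

lemma dualFunctional_X_sub_C_pow {d : ℕ} {W : List ℝ} (hW : W.length = d) (u τ : ℝ) :
    dualFunctional d W u ((X - C τ) ^ d) = (W.map (· - τ)).prod := by
  rw [dualFunctional_apply, taylor_pow, map_sub, taylor_X, taylor_C, add_sub_assoc, ← C_sub]
  set q := (W.map fun s => X + C (s - u)).prod with hq
  have hdeg : q.natDegree < d + 1 := by
    have := natDegree_prod_X_add_C_le W u
    rw [← hq] at this
    omega
  have heval : q.eval (u - τ) = (W.map (· - τ)).prod := by
    rw [hq, eval_list_prod, List.map_map]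
    congr 1
    refine List.map_congr_left fun s _ => ?_
    simp
  rw [← heval, eval_eq_sum_range' hdeg, ← Finset.sum_range_reflect]
  refine Finset.sum_congr rfl fun r hr => ?_
  have hr' : r ≤ d := by have := Finset.mem_range.mp hr; omega
  have : (d.choose r : ℝ) ≠ 0 := by exact_mod_cast (Nat.choose_pos hr').ne'
  rw [coeff_X_add_C_pow, show d + 1 - 1 - r = d - r by omega, Nat.sub_sub_self hr',
    Nat.choose_symm hr']
  field_simp

lemma abs_coeff_prod_X_add_C_le {L : List ℝ} {u M : ℝ} (hM : ∀ s ∈ L, |s - u| ≤ M) (n : ℕ) :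
    |(L.map fun s => X + C (s - u)).prod.coeff n| ≤ ((X + C M : ℝ[X]) ^ L.length).coeff n := by
  induction L generalizing n with
  | nil =>
    rw [List.map_nil, List.prod_nil, List.length_nil, pow_zero, coeff_one]
    split_ifs <;> simp
  | cons s L ih =>
    have hs := hM s List.mem_cons_self
    have ih' := ih fun s hs => hM s (List.mem_cons_of_mem _ hs)
    rw [List.map_cons, List.prod_cons, List.length_cons, pow_succ', add_mul, add_mul, coeff_add,
      coeff_add, coeff_C_mul, coeff_C_mul]
    refine (abs_add_le _ _).trans (add_le_add ?_ ?_)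
    · cases n with
      | zero => simp
      | succ n =>
        rw [coeff_X_mul, coeff_X_mul]
        exact ih' n
    · rw [abs_mul]
      exact mul_le_mul hs (ih' n) (abs_nonneg _) ((abs_nonneg _).trans hs)

lemma abs_dualFunctional_le {d : ℕ} {W : List ℝ} (hW : W.length = d) {u ρ L K : ℝ} (hρ : 0 ≤ ρ)
    (hWu : ∀ s ∈ W, |s - u| ≤ ρ * L) {p : ℝ[X]}
    (hp : ∀ r ≤ d, L ^ r * |(taylor u p).coeff r| ≤ K) :
    |dualFunctional d W u p| ≤ (∑ r ∈ Finset.range (d + 1), ρ ^ r) * K := by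
  rw [dualFunctional_apply, Finset.sum_mul]
  refine (Finset.abs_sum_le_sum_abs _ _).trans (Finset.sum_le_sum fun r hr => ?_)
  have hr' : r ≤ d := by have := Finset.mem_range.mp hr; omega
  have hc : (0 : ℝ) < d.choose r := by exact_mod_cast Nat.choose_pos hr'
  have h := abs_coeff_prod_X_add_C_le hWu (d - r)
  rw [coeff_X_add_C_pow, hW, Nat.sub_sub_self hr', Nat.choose_symm hr'] at h
  rw [abs_mul, abs_div, abs_of_pos hc]
  calc |(W.map fun s => X + C (s - u)).prod.coeff (d - r)| / d.choose r * |(taylor u p).coeff r|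
      ≤ (ρ * L) ^ r * |(taylor u p).coeff r| :=
        mul_le_mul_of_nonneg_right ((div_le_iff₀ hc).mpr h) (abs_nonneg _)
    _ = ρ ^ r * (L ^ r * |(taylor u p).coeff r|) := by rw [mul_pow]; ring
    _ ≤ ρ ^ r * K := mul_le_mul_of_nonneg_left (hp r hr') (pow_nonneg hρ r)

/-! ### Polynomials on an interval -/

/-- The coefficients of a polynomial of bounded degree are controlled by its mean square on
`[0, 1]`, by compactness of the unit sphere in the space of coefficients. -/
lemma exists_coeff_sq_le_integral (d : ℕ) :
    ∃ K : ℝ, 0 < K ∧ ∀ p : ℝ[X], p.natDegree ≤ d → ∀ r, p.coeff r ^ 2 ≤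
      K * ∫ y in (0 : ℝ)..1, p.eval y ^ 2 := by
  set φ : (Fin (d + 1) → ℝ) → ℝ := fun c => ∫ y in (0 : ℝ)..1, (∑ i, c i * y ^ (i : ℕ)) ^ 2 with hφ
  have hcont : Continuous φ := by
    refine intervalIntegral.continuous_parametric_intervalIntegral_of_continuous' ?_ 0 1
    fun_prop
  have hpos : ∀ c ∈ Metric.sphere (0 : Fin (d + 1) → ℝ) 1, 0 < φ c := by
    intro c hc
    set q : ℝ[X] := ∑ i : Fin (d + 1), C (c i) * X ^ (i : ℕ) with hq
    have hqe : ∀ y, q.eval y = ∑ i, c i * y ^ (i : ℕ) := fun y => by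
      simp [hq, eval_finsetSum]
    have hq0 : q ≠ 0 := by
      intro h0
      have : c = 0 := by
        ext i
        have h1 : q.coeff i = c i := by
          rw [hq, finsetSum_coeff, Finset.sum_eq_single i]
          · simp
          · intro j _ hj
            rw [coeff_C_mul, coeff_X_pow, if_neg (fun h => hj (Fin.ext h.symm)), mul_zero]
          · simp
        rw [← h1, h0]
        rfl
      rw [this] at hc
      simp at hc
    obtain ⟨y, hy, hy0⟩ : ∃ y ∈ Set.Icc (0 : ℝ) 1, q.eval y ≠ 0 := by
      by_contra! h
      exact hq0 (eq_zero_of_infinite_isRoot q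
        ((Set.Icc_infinite (zero_lt_one' ℝ)).mono fun y hy => h y hy))
    refine intervalIntegral.integral_pos zero_lt_one (by fun_prop) (fun _ _ => sq_nonneg _)
      ⟨y, hy, ?_⟩
    rw [← hqe]
    positivity
  have hne : (Metric.sphere (0 : Fin (d + 1) → ℝ) 1).Nonempty :=
    NormedSpace.sphere_nonempty.mpr zero_le_one
  obtain ⟨c₀, hc₀, hmin⟩ := (isCompact_sphere (0 : Fin (d + 1) → ℝ) 1).exists_isMinOn hne
    hcont.continuousOn
  have hδ := hpos c₀ hc₀
  refine ⟨(φ c₀)⁻¹, inv_pos.mpr hδ, fun p hp r => ?_⟩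
  set c : Fin (d + 1) → ℝ := fun i => p.coeff i with hc
  have hφc : φ c = ∫ y in (0 : ℝ)..1, p.eval y ^ 2 := by
    simp only [hφ, hc]
    congr 1
    ext y
    rw [eval_eq_sum_range' (show p.natDegree < d + 1 by omega), Finset.sum_range]
  have hrc : |p.coeff r| ≤ ‖c‖ := by
    by_cases hr : r < d + 1
    · exact norm_le_pi_norm c ⟨r, hr⟩
    · rw [coeff_eq_zero_of_natDegree_lt (by omega), abs_zero]
      exact norm_nonneg _
  rw [← hφc, inv_mul_eq_div, le_div_iff₀ hδ]
  rcases eq_or_ne c 0 with h0 | h0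
  · have : p.coeff r = 0 := by
      rw [h0, norm_zero] at hrc
      exact abs_nonpos_iff.mp hrc
    rw [this, hφc]
    simp only [ne_eq, OfNat.ofNat_ne_zero, not_false_eq_true, zero_pow, zero_mul]
    exact intervalIntegral.integral_nonneg zero_le_one fun _ _ => sq_nonneg _
  · have hn : 0 < ‖c‖ := norm_pos_iff.mpr h0
    have hmem : ‖c‖⁻¹ • c ∈ Metric.sphere (0 : Fin (d + 1) → ℝ) 1 := by
      rw [mem_sphere_zero_iff_norm, norm_smul, norm_inv, norm_norm, inv_mul_cancel₀ hn.ne']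
    have h1 : φ c₀ ≤ φ (‖c‖⁻¹ • c) := hmin hmem
    have h2 : φ (‖c‖⁻¹ • c) = (‖c‖⁻¹) ^ 2 * φ c := by
      simp only [hφ]
      rw [← intervalIntegral.integral_const_mul]
      congr 1
      ext y
      simp only [Pi.smul_apply, smul_eq_mul, mul_assoc]
      rw [← Finset.mul_sum, mul_pow]
    rw [h2, inv_pow, inv_mul_eq_div, le_div_iff₀ (by positivity)] at h1
    calc p.coeff r ^ 2 * φ c₀ ≤ ‖c‖ ^ 2 * φ c₀ := by
          rw [← sq_abs]
          gcongr
      _ ≤ φ c := by linarith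

/-- Bounds for polynomials of bounded degree on an interval in terms of their mean square. -/
lemma exists_taylor_coeff_sq_le (d : ℕ) :
    ∃ K : ℝ, 0 < K ∧ ∀ p : ℝ[X], p.natDegree ≤ d → ∀ u v : ℝ, u < v → ∀ r,
      ((v - u) ^ r * |(taylor u p).coeff r|) ^ 2 ≤
        K * ((v - u)⁻¹ * ∫ y in u..v, p.eval y ^ 2) := by
  obtain ⟨K, hK, h⟩ := exists_coeff_sq_le_integral d
  refine ⟨K, hK, fun p hp u v huv r => ?_⟩
  have hL : v - u ≠ 0 := by linarith
  have h1 := h ((taylor u p).comp (C (v - u) * X)) ?_ r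
  · rw [comp_C_mul_X_coeff] at h1
    rw [mul_pow, sq_abs, ← mul_pow, mul_comm]
    refine h1.trans_eq ?_
    congr 1
    have e : ∀ y, ((taylor u p).comp (C (v - u) * X)).eval y = p.eval ((v - u) * y + u) := by
      intro y
      rw [eval_comp, eval_mul, eval_C, eval_X, taylor_eval]
    simp only [e]
    rw [intervalIntegral.integral_comp_mul_add (fun y => p.eval y ^ 2) hL u]
    simp
  · refine natDegree_comp_le.trans ?_
    rw [natDegree_taylor]
    exact (Nat.mul_le_mul hp ((natDegree_C_mul_le _ _).trans natDegree_X_le)).trans_eq (mul_one d)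

lemma exists_eval_sq_le (d : ℕ) :
    ∃ K : ℝ, 0 < K ∧ ∀ p : ℝ[X], p.natDegree ≤ d → ∀ u v : ℝ, u < v → ∀ x ∈ Set.Icc u v,
      p.eval x ^ 2 ≤ K * ((v - u)⁻¹ * ∫ y in u..v, p.eval y ^ 2) := by
  obtain ⟨K, hK, h⟩ := exists_taylor_coeff_sq_le d
  refine ⟨(d + 1) * ((d + 1) * K), by positivity, fun p hp u v huv x hx => ?_⟩
  set M := (v - u)⁻¹ * ∫ y in u..v, p.eval y ^ 2
  have e : p.eval x = ∑ r ∈ Finset.range (d + 1), (taylor u p).coeff r * (x - u) ^ r := by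
    rw [← eval_eq_sum_range' (by rw [natDegree_taylor]; omega), taylor_eval, sub_add_cancel]
  rw [e]
  refine sq_sum_le_card_mul_sum_sq.trans ?_
  rw [Finset.card_range, mul_assoc ((d : ℝ) + 1)]
  push_cast
  refine mul_le_mul_of_nonneg_left ?_ (by positivity)
  have : ∀ r ∈ Finset.range (d + 1), ((taylor u p).coeff r * (x - u) ^ r) ^ 2 ≤ K * M := by
    intro r _
    refine le_trans ?_ (h p hp u v huv r)
    rw [mul_comm, mul_pow, mul_pow _ |_|, sq_abs]
    have hxu : 0 ≤ x - u := by linarith [hx.1]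
    exact mul_le_mul_of_nonneg_right (pow_le_pow_left₀ (pow_nonneg hxu r)
      (pow_le_pow_left₀ hxu (by linarith [hx.2]) r) 2) (sq_nonneg _)
  refine (Finset.sum_le_card_nsmul _ _ _ this).trans_eq ?_
  rw [Finset.card_range, nsmul_eq_mul]
  push_cast
  ring

end BSpline

/-! ### Local stability of the B-spline coefficients -/

/-- A function that is bounded by a multiple of its mean on an interval is at least half its mean on
a substantial part of the interval. -/
lemma le_volume_half_mean_le {H : ℝ → ℝ} (hH : Continuous H) (h0 : ∀ x, 0 ≤ H x) {u v K : ℝ}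
    (huv : u < v) (hK : 1 ≤ K)
    (hsup : ∀ x ∈ Set.Icc u v, H x ≤ K * ((v - u)⁻¹ * ∫ y in u..v, H y)) :
    ENNReal.ofReal ((v - u) / (2 * K)) ≤
      volume {y | y ∈ Set.Ioo u v ∧ ((v - u)⁻¹ * ∫ y in u..v, H y) / 2 ≤ H y} := by
  set M := (v - u)⁻¹ * ∫ y in u..v, H y with hM
  have hL : 0 < v - u := by linarith
  have hM0 : 0 ≤ M := mul_nonneg (inv_nonneg.mpr hL.le)
    (intervalIntegral.integral_nonneg huv.le fun _ _ => h0 _)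
  set G : Set ℝ := {y | y ∈ Set.Ioo u v ∧ M / 2 ≤ H y} with hG
  have hGm : MeasurableSet G :=
    measurableSet_Ioo.inter (measurableSet_le measurable_const hH.measurable)
  have hGsub : G ⊆ Set.Ioo u v := fun y hy => hy.1
  have hGfin : volume G ≠ ⊤ := measure_ne_top_of_subset hGsub (by simp)
  rw [ENNReal.ofReal_le_iff_le_toReal hGfin]
  change _ ≤ volume.real G
  rcases hM0.eq_or_lt with hM0 | hM0
  · have : G = Set.Ioo u v := by
      refine subset_antisymm hGsub fun y hy => ⟨hy, ?_⟩
      rw [← hM0, zero_div]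
      exact h0 y
    rw [this, Real.volume_real_Ioo_of_le huv.le]
    exact div_le_self hL.le (by linarith)
  · have hint : IntegrableOn H (Set.Ioo u v) :=
      (hH.integrableOn_Icc (a := u) (b := v)).mono_set Set.Ioo_subset_Icc_self
    have hc1 : IntegrableOn (fun _ => M / 2) (Set.Ioo u v) := integrableOn_const (by simp)
    have hc2 : IntegrableOn (G.indicator fun _ => K * M) (Set.Ioo u v) :=
      (integrableOn_const (μ := volume) (s := Set.Ioo u v) (C := K * M) (by simp)).indicator hGm
    have hint2 : IntegrableOn (fun y => M / 2 + G.indicator (fun _ => K * M) y)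
        (Set.Ioo u v) := hc1.add hc2
    have h1 : ∫ y in Set.Ioo u v, H y ≤
        ∫ y in Set.Ioo u v, (M / 2 + G.indicator (fun _ => K * M) y) := by
      refine setIntegral_mono_on hint hint2 measurableSet_Ioo fun y hy => ?_
      by_cases hy' : y ∈ G
      · rw [Set.indicator_of_mem hy']
        have := hsup y (Set.Ioo_subset_Icc_self hy)
        linarith
      · rw [Set.indicator_of_notMem hy', add_zero]
        by_contra! h
        exact hy' ⟨hy, h.le⟩
    have h2 : ∫ y in Set.Ioo u v, H y = (v - u) * M := by
      rw [hM, intervalIntegral.integral_of_le huv.le, integral_Ioc_eq_integral_Ioo]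
      field_simp
    have h3 : ∫ y in Set.Ioo u v, (M / 2 + G.indicator (fun _ => K * M) y) =
        (v - u) * (M / 2) + volume.real G * (K * M) := by
      rw [integral_add hc1 hc2, setIntegral_const,
        setIntegral_indicator hGm, Set.inter_eq_self_of_subset_right hGsub, setIntegral_const,
        Real.volume_real_Ioo_of_le huv.le, smul_eq_mul, smul_eq_mul]
    rw [h2, h3] at h1
    rw [div_le_iff₀ (by linarith)]
    have h4 : M * (v - u) ≤ M * (volume.real G * (2 * K)) := by linarith
    exact le_of_mul_le_mul_left h4 hM0

namespace IntervalPartition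

open BSpline Polynomial

variable {P : IntervalPartition} {k : ℕ}

lemma natDegree_le_of_degree_lt {p : ℝ[X]} (hk : 1 ≤ k) (hp : p.degree < (k : WithBot ℕ)) :
    p.natDegree ≤ k - 1 := by
  by_cases h0 : p = 0
  · simp [h0]
  · have := (natDegree_lt_iff_degree_lt h0).mpr hp
    omega

lemma card_parts_pos (P : IntervalPartition) : 0 < P.parts.card := by
  obtain ⟨A, hA, -⟩ := P.cover 0
  exact Finset.card_pos.mpr ⟨A, hA⟩

lemma knot_lt_knot_add (hk : 1 ≤ k) {j : ℕ} (hj : j < P.parts.card + (k - 1)) :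
    P.knot k j < P.knot k (j + k) := by
  rcases lt_or_ge (P.knot k j) 1 with h | h
  · by_cases hjk : k - 1 ≤ j
    · exact (knot_lt_succ hjk h).trans_le (P.monotone_knot k (by omega))
    · rw [knot_eq_tau, knot_eq_tau, show j - (k - 1) = 0 by omega]
      exact (P.tau_lt zero_lt_one P.card_parts_pos).trans_le (P.monotone_tau (by omega))
  · exfalso
    rw [knot_eq_tau] at h
    have := P.tau_lt (show j - (k - 1) < P.parts.card by have := P.card_parts_pos; omega) le_rfl
    rw [P.tau_eq_one le_rfl] at this
    linarith

/-- One of the at most `k` atoms in the support of a B-spline has at least the average length. -/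
lemma exists_long_atom (hk : 1 ≤ k) {j : ℕ} (hj : j < P.parts.card + (k - 1)) :
    ∃ a, j ≤ a ∧ a ≤ j + (k - 1) ∧ P.knot k a < P.knot k (a + 1) ∧
      P.knot k (j + k) - P.knot k j ≤ k * (P.knot k (a + 1) - P.knot k a) := by
  have hk' : (0 : ℝ) < k := by exact_mod_cast hk
  have hlt := knot_lt_knot_add hk hj
  have hsum : ∑ i ∈ Finset.range k, (P.knot k (j + k) - P.knot k j) / k ≤
      ∑ i ∈ Finset.range k, (P.knot k (j + (i + 1)) - P.knot k (j + i)) := by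
    rw [Finset.sum_range_sub (fun i => P.knot k (j + i)), Finset.sum_const, Finset.card_range,
      nsmul_eq_mul, mul_div_cancel₀ _ hk'.ne', add_zero]
  obtain ⟨i, hi, h⟩ := Finset.exists_le_of_sum_le (Finset.nonempty_range_iff.mpr (by omega)) hsum
  have hi' := Finset.mem_range.mp hi
  rw [div_le_iff₀' hk'] at h
  refine ⟨j + i, by omega, by omega, ?_, h⟩
  by_contra! h'
  have : (k : ℝ) * (P.knot k (j + (i + 1)) - P.knot k (j + i)) ≤ 0 :=
    mul_nonpos_of_nonneg_of_nonpos hk'.le (sub_nonpos.mpr h')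
  linarith

lemma IsAtom.eq {a : ℕ} {A A' : Set unitInterval} (h : P.IsAtom k a A) (h' : P.IsAtom k a A') :
    A = A' :=
  P.leftEnd_injOn h.mem_parts h'.mem_parts (h.leftEnd_eq.trans h'.leftEnd_eq.symm)

lemma IsSpline.exists_pieces {f : unitInterval → ℝ} (hf : P.IsSpline k f) :
    ∃ p : ℕ → ℝ[X], (∀ a, (p a).degree < (k : WithBot ℕ)) ∧
      ∀ a A, P.IsAtom k a A → ∀ x ∈ A, f x = (p a).eval (x : ℝ) := by
  have h : ∀ a, ∃ p : ℝ[X], p.degree < (k : WithBot ℕ) ∧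
      ∀ A, P.IsAtom k a A → ∀ x ∈ A, f x = p.eval (x : ℝ) := by
    intro a
    by_cases h : ∃ A, P.IsAtom k a A
    · obtain ⟨A, hA⟩ := h
      obtain ⟨p, hp, hp'⟩ := hf.2 A hA.mem_parts
      exact ⟨p, hp, fun A' hA' => hA.eq hA' ▸ hp'⟩
    · push Not at h
      exact ⟨0, by rw [degree_zero]; exact WithBot.bot_lt_coe k, fun A hA => absurd hA (h A)⟩
  choose p hp hp' using h
  exact ⟨p, hp, hp'⟩

/-- The functional dual to a B-spline takes the same value at all pieces of a spline on the support
of that B-spline. -/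
lemma IsSpline.dualFunctional_eq {f : unitInterval → ℝ} (hf : P.IsSpline k f) (hk : 1 ≤ k)
    {p : ℕ → ℝ[X]} (hp : ∀ a, (p a).degree < (k : WithBot ℕ))
    (hfp : ∀ a A, P.IsAtom k a A → ∀ x ∈ A, f x = (p a).eval (x : ℝ)) {j a a' : ℕ} (u : ℝ)
    (hja : j ≤ a) (haa' : a ≤ a') (ha' : a' ≤ j + (k - 1)) (hlt : P.knot k a < P.knot k (a + 1))
    (hlt' : P.knot k a' < P.knot k (a' + 1)) :
    dualFunctional (k - 1) (window (P.knot k) j (k - 1)) u (p a) =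
      dualFunctional (k - 1) (window (P.knot k) j (k - 1)) u (p a') := by
  have hda := (index_bounds_of_knot_lt hlt).1
  induction a', haa' using Nat.le_induction with
  | base => rfl
  | succ b hab ih =>
    have hb : P.knot k b < P.knot k (b + 1) := by
      refine knot_lt_succ (hda.trans hab) ((P.monotone_knot k (Nat.le_succ b)).trans_lt ?_)
      exact hlt'.trans_le (P.knot_le_one k _)
    rw [ih (by omega) hb, ← sub_eq_zero, ← map_sub]
    obtain ⟨A, hA⟩ := exists_isAtom_of_lt hb
    obtain ⟨A', hA'⟩ := exists_isAtom_of_lt hlt'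
    obtain ⟨c, hc⟩ := hf.sub_eq hk hA hA' (hp b) (hp (b + 1)) (hfp b A hA) (hfp (b + 1) A' hA')
    rw [hc, ← smul_eq_C_mul, map_smul, dualFunctional_X_sub_C_pow (length_window _ _ _),
      List.prod_eq_zero, smul_zero]
    exact List.mem_map.mpr ⟨_, mem_window.mpr ⟨b + 1, by omega, ha', rfl⟩, sub_self _⟩

/-- A spline is the combination of the B-splines whose coefficients are the values of the dual
functionals at any of its pieces on the supports of the B-splines. -/
lemma IsSpline.eq_sum_dualFunctional {f : unitInterval → ℝ} (hf : P.IsSpline k f) (hk : 1 ≤ k)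
    {p : ℕ → ℝ[X]} (hp : ∀ a, (p a).degree < (k : WithBot ℕ))
    (hfp : ∀ a A, P.IsAtom k a A → ∀ x ∈ A, f x = (p a).eval (x : ℝ)) (α : ℕ → ℕ) (u : ℕ → ℝ)
    (hα : ∀ j < P.parts.card + (k - 1), j ≤ α j ∧ α j ≤ j + (k - 1) ∧
      P.knot k (α j) < P.knot k (α j + 1)) (x : unitInterval) :
    f x = ∑ j ∈ Finset.range (P.parts.card + (k - 1)),
      dualFunctional (k - 1) (window (P.knot k) j (k - 1)) (u j) (p (α j)) *
        P.bspline k j x := by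
  obtain ⟨a, A, hA, hx⟩ := P.exists_isAtom_mem k x
  obtain ⟨w, c, hwc⟩ := exists_eq_sum_X_sub_C_pow (natDegree_le_of_degree_lt hk (hp a))
  have h1 : ∀ j ∈ Finset.range (P.parts.card + (k - 1)),
      dualFunctional (k - 1) (window (P.knot k) j (k - 1)) (u j) (p (α j)) * P.bspline k j x =
      ∑ i, w i * (((window (P.knot k) j (k - 1)).map (· - c i)).prod * P.bspline k j x) := by
    intro j hj
    by_cases h0 : P.bspline k j x = 0
    · simp [h0]
    rw [hA.bspline_eq hx] at h0
    obtain ⟨h2, h3⟩ := index_bounds_of_blossom_ne_zero h0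
    obtain ⟨h4, h5, h6⟩ := hα j (Finset.mem_range.mp hj)
    have h7 : dualFunctional (k - 1) (window (P.knot k) j (k - 1)) (u j) (p (α j)) =
        dualFunctional (k - 1) (window (P.knot k) j (k - 1)) (u j) (p a) := by
      rcases le_total (α j) a with h | h
      · exact hf.dualFunctional_eq hk hp hfp (u j) h4 h h3 h6 hA.lt
      · exact (hf.dualFunctional_eq hk hp hfp (u j) h2 h h5 hA.lt h6).symm
    rw [h7, hwc, map_sum, Finset.sum_mul]
    refine Finset.sum_congr rfl fun i _ => ?_
    rw [← smul_eq_C_mul, map_smul, dualFunctional_X_sub_C_pow (length_window _ _ _), smul_eq_mul,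
      mul_assoc]
  rw [Finset.sum_congr rfl h1, Finset.sum_comm, hfp a A hA x hx, hwc, eval_finsetSum]
  refine Finset.sum_congr rfl fun i _ => ?_
  rw [← Finset.mul_sum, hA.sum_window_mul_bspline hx (isPolarForm_prod _ (c i))]
  simp

/-- Minkowski's inequality for the square function. -/
lemma sqrt_sum_sq_le {ι κ : Type*} (s : Finset ι) (J : Finset κ) (c : ι → κ → ℝ) {N : κ → ℝ}
    (hN : ∀ j ∈ J, 0 ≤ N j) :
    Real.sqrt (∑ l ∈ s, (∑ j ∈ J, c l j * N j) ^ 2) ≤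
      ∑ j ∈ J, Real.sqrt (∑ l ∈ s, c l j ^ 2) * N j := by
  set F : ι → ℝ := fun l => ∑ j ∈ J, c l j * N j
  set S := Real.sqrt (∑ l ∈ s, F l ^ 2) with hS
  have hT : 0 ≤ ∑ j ∈ J, Real.sqrt (∑ l ∈ s, c l j ^ 2) * N j :=
    Finset.sum_nonneg fun j hj => mul_nonneg (Real.sqrt_nonneg _) (hN j hj)
  have key : S * S ≤ S * ∑ j ∈ J, Real.sqrt (∑ l ∈ s, c l j ^ 2) * N j := by
    calc S * S = ∑ l ∈ s, F l * ∑ j ∈ J, c l j * N j := by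
          rw [hS, Real.mul_self_sqrt (Finset.sum_nonneg fun _ _ => sq_nonneg _)]
          exact Finset.sum_congr rfl fun l _ => sq (F l)
      _ = ∑ j ∈ J, (∑ l ∈ s, F l * c l j) * N j := by
          simp only [Finset.mul_sum, Finset.sum_mul]
          rw [Finset.sum_comm]
          exact Finset.sum_congr rfl fun j _ => Finset.sum_congr rfl fun l _ => by ring
      _ ≤ ∑ j ∈ J, (S * Real.sqrt (∑ l ∈ s, c l j ^ 2)) * N j :=
          Finset.sum_le_sum fun j hj => mul_le_mul_of_nonneg_right
            (Real.sum_mul_le_sqrt_mul_sqrt _ _ _) (hN j hj)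
      _ = S * ∑ j ∈ J, Real.sqrt (∑ l ∈ s, c l j ^ 2) * N j := by
          rw [Finset.mul_sum]
          exact Finset.sum_congr rfl fun j _ => by ring
  have hS0 : 0 ≤ S := Real.sqrt_nonneg _
  rcases hS0.eq_or_lt with h | h
  · rw [← h]
    exact hT
  · exact le_of_mul_le_mul_left key h

/-- A square function of splines is dominated by a spline whose coefficients `ν j` are, up to a
constant, attained by the square function on a substantial part `G j` of the support of the
B-spline.  The coefficient is a multiple of the quadratic mean of the square function over the
longest atom in the support. -/
theorem exists_coeff_sqrt_sum_sq_le (hk : 1 ≤ k) :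
    ∃ c C : ℝ, 0 < c ∧ 0 < C ∧ ∀ (P : IntervalPartition) (s : Finset ℕ)
      (f : ℕ → unitInterval → ℝ), (∀ l ∈ s, P.IsSpline k (f l)) →
      ∃ (ν : ℕ → ℝ) (G : ℕ → Set ℝ),
        (∀ j, 0 ≤ ν j) ∧
        (∀ j < P.parts.card + (k - 1), MeasurableSet (G j) ∧
          G j ⊆ Set.Icc (P.knot k j) (P.knot k (j + k)) ∧
          ENNReal.ofReal (c * (P.knot k (j + k) - P.knot k j)) ≤ volume (G j) ∧
          ∀ x : unitInterval, (x : ℝ) ∈ G j → ν j ≤ C * Real.sqrt (∑ l ∈ s, f l x ^ 2)) ∧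
        ∀ x, Real.sqrt (∑ l ∈ s, f l x ^ 2) ≤
          ∑ j ∈ Finset.range (P.parts.card + (k - 1)), ν j * P.bspline k j x := by
  obtain ⟨K, hK, hcoeff⟩ := exists_taylor_coeff_sq_le (k - 1)
  obtain ⟨K', hK', heval⟩ := exists_eval_sq_le (k - 1)
  have hk' : (0 : ℝ) < k := by exact_mod_cast hk
  set S : ℝ := ∑ r ∈ Finset.range (k - 1 + 1), (k : ℝ) ^ r with hS
  have hS0 : 0 < S := Finset.sum_pos (fun r _ => pow_pos hk' r) (by simp)
  set K₁ := max K' 1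
  refine ⟨(2 * K₁ * k)⁻¹, Real.sqrt (S ^ 2 * K * 2), by positivity, by positivity,
    fun P s f hf => ?_⟩
  choose! p hp hfp using fun l hl => (hf l hl).exists_pieces
  choose! α hα1 hα2 hα3 hα4 using fun j (hj : j < P.parts.card + (k - 1)) =>
    exists_long_atom hk hj
  set t := P.knot k
  set u : ℕ → ℝ := fun j => t (α j) with hu
  set v : ℕ → ℝ := fun j => t (α j + 1) with hv
  set H : ℕ → ℝ → ℝ := fun j y => ∑ l ∈ s, (p l (α j)).eval y ^ 2 with hH
  set M : ℕ → ℝ := fun j => (v j - u j)⁻¹ * ∫ y in u j..v j, H j y with hM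
  have hMsum : ∀ j, M j =
      ∑ l ∈ s, (v j - u j)⁻¹ * ∫ y in u j..v j, (p l (α j)).eval y ^ 2 := fun j => by
    simp only [hM, hH]
    rw [intervalIntegral.integral_finsetSum fun l _ =>
      (Continuous.intervalIntegrable (by fun_prop) _ _), Finset.mul_sum]
  have hdeg : ∀ l ∈ s, ∀ a, (p l a).natDegree ≤ k - 1 := fun l hl a =>
    natDegree_le_of_degree_lt hk (hp l hl a)
  refine ⟨fun j => Real.sqrt (S ^ 2 * K * M j),
    fun j => {y | y ∈ Set.Ioo (u j) (v j) ∧ M j / 2 ≤ H j y},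
    fun j => Real.sqrt_nonneg _, fun j hj => ⟨?_, ?_, ?_, ?_⟩, fun x => ?_⟩
  · have hHm : Measurable (H j) := Continuous.measurable (by fun_prop)
    exact measurableSet_Ioo.inter (measurableSet_le measurable_const hHm)
  · rintro y ⟨hy, -⟩
    have h1 := P.monotone_knot k (hα1 j hj)
    have h2 := P.monotone_knot k (show α j + 1 ≤ j + k by have := hα2 j hj; omega)
    exact ⟨h1.trans hy.1.le, hy.2.le.trans h2⟩
  · refine le_trans (ENNReal.ofReal_le_ofReal ?_) (le_volume_half_mean_le (H := H j)
      (by fun_prop) (fun _ => Finset.sum_nonneg fun _ _ => sq_nonneg _) (hα3 j hj)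
      (le_max_right K' 1) fun y hy => ?_)
    · have h1 := hα4 j hj
      rw [mul_inv, inv_mul_eq_div, div_mul_eq_mul_div, mul_comm, ← div_eq_mul_inv,
        div_le_div_iff_of_pos_right (by positivity), div_le_iff₀' hk']
      exact h1
    · change H j y ≤ K₁ * M j
      rw [hMsum, Finset.mul_sum]
      refine Finset.sum_le_sum fun l hl => ?_
      refine (heval _ (hdeg l hl _) _ _ (hα3 j hj) y hy).trans ?_
      refine mul_le_mul_of_nonneg_right (le_max_left _ _) ?_
      exact mul_nonneg (inv_nonneg.mpr (sub_nonneg.mpr (hα3 j hj).le))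
        (intervalIntegral.integral_nonneg (hα3 j hj).le fun _ _ => sq_nonneg _)
  · rintro x ⟨hx, hx'⟩
    obtain ⟨A, hA⟩ := exists_isAtom_of_lt (hα3 j hj)
    have hxA := hA.mem hx.1 hx.2
    rw [← Real.sqrt_mul (by positivity)]
    refine Real.sqrt_le_sqrt ?_
    rw [mul_assoc (S ^ 2 * K)]
    refine mul_le_mul_of_nonneg_left ?_ (by positivity)
    have : H j x = ∑ l ∈ s, f l x ^ 2 :=
      Finset.sum_congr rfl fun l hl => by rw [hfp l hl _ A hA x hxA]
    rw [← this]
    linarith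
  · set Λ : ℕ → ℕ → ℝ := fun l j =>
      dualFunctional (k - 1) (window t j (k - 1)) (u j) (p l (α j)) with hΛ
    have h1 : ∑ l ∈ s, f l x ^ 2 = ∑ l ∈ s,
        (∑ j ∈ Finset.range (P.parts.card + (k - 1)), Λ l j * P.bspline k j x) ^ 2 :=
      Finset.sum_congr rfl fun l hl => by
        rw [(hf l hl).eq_sum_dualFunctional hk (hp l hl) (hfp l hl) α u
          (fun j hj => ⟨hα1 j hj, hα2 j hj, hα3 j hj⟩) x]
    rw [h1]
    refine (sqrt_sum_sq_le _ _ Λ fun j _ => P.bspline_nonneg k j x).trans ?_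
    refine Finset.sum_le_sum fun j hj => ?_
    have hj := Finset.mem_range.mp hj
    refine mul_le_mul_of_nonneg_right (Real.sqrt_le_sqrt ?_) (P.bspline_nonneg k j x)
    rw [hMsum, Finset.mul_sum]
    refine Finset.sum_le_sum fun l hl => ?_
    set m := (v j - u j)⁻¹ * ∫ y in u j..v j, (p l (α j)).eval y ^ 2
    have h2 : |Λ l j| ≤ S * Real.sqrt (K * m) := by
      refine abs_dualFunctional_le (L := v j - u j) (length_window _ _ _) hk'.le ?_ ?_
      · intro y hy
        obtain ⟨i, hi1, hi2, rfl⟩ := mem_window.mp hy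
        have h3 := P.monotone_knot k hi1.le
        have h4 := P.monotone_knot k (show i ≤ j + k by omega)
        have h5 := P.monotone_knot k (hα1 j hj)
        have h6 := P.monotone_knot k (show α j ≤ j + k by have := hα2 j hj; omega)
        have h7 := hα4 j hj
        change |P.knot k i - P.knot k (α j)| ≤ k * (P.knot k (α j + 1) - P.knot k (α j))
        rw [abs_le]
        constructor <;> linarith
      · intro r _
        exact Real.le_sqrt_of_sq_le (hcoeff _ (hdeg l hl _) _ _ (hα3 j hj) r)
    have hm : 0 ≤ K * m := le_trans (sq_nonneg _) (hcoeff _ (hdeg l hl (α j)) _ _ (hα3 j hj) 0)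
    calc Λ l j ^ 2 = |Λ l j| ^ 2 := (sq_abs _).symm
      _ ≤ (S * Real.sqrt (K * m)) ^ 2 := pow_le_pow_left₀ (abs_nonneg _) h2 2
      _ = S ^ 2 * K * m := by rw [mul_pow, Real.sq_sqrt hm, mul_assoc]

end IntervalPartition

/-! ### A covering argument -/

/-- A finite union of intervals is not much longer than the union of substantial parts of them, by
Vitali's covering lemma. -/
lemma volume_biUnion_Icc_le {ι : Type*} (s : Finset ι) {lo hi : ι → ℝ} {G : ι → Set ℝ} {c : ℝ}
    (hc : 0 < c) (hG : ∀ i ∈ s, MeasurableSet (G i))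
    (hGsub : ∀ i ∈ s, G i ⊆ Set.Icc (lo i) (hi i))
    (hGvol : ∀ i ∈ s, ENNReal.ofReal (c * (hi i - lo i)) ≤ volume (G i)) :
    volume (⋃ i ∈ s, Set.Icc (lo i) (hi i)) ≤
      ENNReal.ofReal (5 / c) * volume (⋃ i ∈ s, G i) := by
  have hball : ∀ i, Metric.closedBall ((lo i + hi i) / 2) ((hi i - lo i) / 2) =
      Set.Icc (lo i) (hi i) := fun i => by
    rw [Real.closedBall_eq_Icc]
    congr 1 <;> ring
  obtain ⟨R, hR⟩ := (s.image fun i => (hi i - lo i) / 2).bddAbove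
  obtain ⟨w, hws, hdisj, hcov⟩ := Vitali.exists_disjoint_subfamily_covering_enlargement_closedBall
    (s : Set ι) (fun i => (lo i + hi i) / 2) (fun i => (hi i - lo i) / 2) R
    (fun i hi' => hR (Finset.mem_coe.mpr (Finset.mem_image_of_mem _ hi'))) 5 (by norm_num)
  have hwfin : w.Finite := s.finite_toSet.subset hws
  have hw : ∀ i ∈ hwfin.toFinset, i ∈ s := fun i hi' => hws (hwfin.mem_toFinset.mp hi')
  calc volume (⋃ i ∈ s, Set.Icc (lo i) (hi i))
      ≤ volume (⋃ i ∈ hwfin.toFinset,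
          Metric.closedBall ((lo i + hi i) / 2) (5 * ((hi i - lo i) / 2))) := by
        refine measure_mono (Set.iUnion₂_subset fun i hi' => ?_)
        obtain ⟨b, hb, hsub⟩ := hcov i hi'
        rw [hball] at hsub
        exact hsub.trans (Set.subset_biUnion_of_mem
          (u := fun i => Metric.closedBall ((lo i + hi i) / 2) (5 * ((hi i - lo i) / 2)))
          (hwfin.mem_toFinset.mpr hb))
    _ ≤ ∑ i ∈ hwfin.toFinset,
          volume (Metric.closedBall ((lo i + hi i) / 2) (5 * ((hi i - lo i) / 2))) :=
        measure_biUnion_finset_le _ _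
    _ ≤ ∑ i ∈ hwfin.toFinset, ENNReal.ofReal (5 / c) * volume (G i) := by
        refine Finset.sum_le_sum fun i hi' => ?_
        have h5 : (0 : ℝ) ≤ 5 / c := by positivity
        rw [Real.volume_closedBall]
        refine le_trans (le_of_eq ?_) (mul_le_mul_right (hGvol i (hw i hi')) _)
        rw [← ENNReal.ofReal_mul h5]
        congr 1
        field_simp
    _ = ENNReal.ofReal (5 / c) * volume (⋃ i ∈ hwfin.toFinset, G i) := by
        rw [← Finset.mul_sum, measure_biUnion_finset _ fun i hi' => hG i (hw i hi')]
        intro i hi' j hj' hij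
        have := hdisj (hwfin.mem_toFinset.mp hi') (hwfin.mem_toFinset.mp hj') hij
        simp only [Function.onFun, hball] at this
        exact this.mono (hGsub i (hw i hi')) (hGsub j (hw j hj'))
    _ ≤ ENNReal.ofReal (5 / c) * volume (⋃ i ∈ s, G i) := by
        refine mul_le_mul_right (measure_mono ?_) _
        exact Set.iUnion₂_subset fun i hi' =>
          Set.subset_iUnion₂ (s := fun i (_ : i ∈ s) => G i) i (hw i hi')

/-! ### The dominating splines -/

lemma integral_le_of_measure_lt_le {α : Type*} [MeasurableSpace α] {μ : Measure α} {g h : α → ℝ}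
    (hg : Measurable g) (hg0 : ∀ x, 0 ≤ g x) (hh0 : ∀ x, 0 ≤ h x) (hh : Measurable h)
    (hint : Integrable h μ) {D : ℝ} (hD : 0 ≤ D)
    (hgh : ∀ t, 0 < t → μ {x | t < g x} ≤ ENNReal.ofReal D * μ {x | t < h x}) :
    ∫ x, g x ∂μ ≤ D * ∫ x, h x ∂μ := by
  have h1 : ∫⁻ x, ENNReal.ofReal (g x) ∂μ ≤
      ENNReal.ofReal D * ∫⁻ x, ENNReal.ofReal (h x) ∂μ := by
    rw [lintegral_eq_lintegral_meas_lt μ (Filter.Eventually.of_forall hg0) hg.aemeasurable,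
      lintegral_eq_lintegral_meas_lt μ (Filter.Eventually.of_forall hh0) hh.aemeasurable,
      ← lintegral_const_mul' _ _ ENNReal.ofReal_ne_top]
    exact setLIntegral_mono' measurableSet_Ioi fun t ht => hgh t ht
  rw [← ofReal_integral_eq_lintegral_ofReal hint (Filter.Eventually.of_forall hh0),
    ← ENNReal.ofReal_mul hD] at h1
  rw [integral_eq_lintegral_of_nonneg_ae (Filter.Eventually.of_forall hg0)
    hg.aestronglyMeasurable]
  exact ENNReal.toReal_le_of_le_ofReal (mul_nonneg hD (integral_nonneg hh0)) h1

namespace IntervalPartition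

variable {P : IntervalPartition} {k : ℕ}

lemma IsSpline.measurable {f : unitInterval → ℝ} (hf : P.IsSpline k f) : Measurable f := by
  choose! p _ hfp using hf.2
  intro s hs
  have h : f ⁻¹' s = ⋃ A ∈ P.parts, A ∩ (fun x : unitInterval => (p A).eval (x : ℝ)) ⁻¹' s := by
    ext x
    obtain ⟨A, hA, hx⟩ := P.cover x
    simp only [Set.mem_preimage, Set.mem_iUnion, Set.mem_inter_iff, exists_prop]
    constructor
    · intro h
      exact ⟨A, hA, hx, by rwa [← hfp A hA x hx]⟩
    · rintro ⟨B, hB, hxB, h⟩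
      rwa [hfp B hB x hxB]
  rw [h]
  refine Finset.measurableSet_biUnion _ fun A hA => (P.ordConnected A hA).measurableSet.inter ?_
  exact ((p A).continuous.comp continuous_subtype_val).measurable hs

lemma bspline_le_one (P : IntervalPartition) {k j : ℕ} (hj : j < P.parts.card + (k - 1))
    (x : unitInterval) : P.bspline k j x ≤ 1 := by
  rw [← P.sum_bspline k x]
  exact Finset.single_le_sum (fun i _ => P.bspline_nonneg k i x) (Finset.mem_range.mpr hj)

/-- The domination theorem for a fixed order, with a constant that does not depend on the
partitions.  The coefficient of the `n`-th dominating spline at a B-spline is the maximum of the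
coefficients of the square functions, up to time `n`, at the B-splines with larger supports. -/
theorem exists_monotone_splines (hk : 1 ≤ k) :
    ∃ D : ℝ, ∀ ℱ : ℕ → IntervalPartition, Monotone (fun n => (ℱ n).sigmaAlgebra) →
      ∀ f : ℕ → unitInterval → ℝ, (∀ n, (ℱ n).IsSpline k (f n)) →
      ∃ g : ℕ → unitInterval → ℝ, ∀ n,
        (ℱ n).IsSpline k (g n) ∧
        (∀ x, 0 ≤ g n x) ∧
        (∀ x, g n x ≤ g (n + 1) x) ∧
        (∀ x, Real.sqrt (∑ l ∈ Finset.range (n + 1), f l x ^ 2) ≤ g n x) ∧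
        ∫ x, g n x ≤ D * ∫ x, Real.sqrt (∑ l ∈ Finset.range (n + 1), f l x ^ 2) := by
  classical
  obtain ⟨c, C, hc, hC, hcoeff⟩ := exists_coeff_sqrt_sum_sq_le hk
  refine ⟨5 / c * C, fun ℱ hℱ f hf => ?_⟩
  have hsp : ∀ n, ∀ l ∈ Finset.range (n + 1), (ℱ n).IsSpline k (f l) := fun n l hl =>
    (hf l).refine (hℱ (Nat.lt_succ_iff.mp (Finset.mem_range.mp hl)))
  choose ν G hν0 hG hdom using fun n => hcoeff (ℱ n) (Finset.range (n + 1)) f (hsp n)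
  set m : ℕ → ℕ := fun n => (ℱ n).parts.card + (k - 1)
  set t : ℕ → ℕ → ℝ := fun n => (ℱ n).knot k
  let I : ℕ → Finset (Σ _ : ℕ, ℕ) := fun n =>
    (Finset.range (n + 1)).sigma fun l => Finset.range (m l)
  have hI : ∀ n q, q ∈ I n ↔ q.1 ≤ n ∧ q.2 < m q.1 := fun n q => by
    simp only [I, Finset.mem_sigma, Finset.mem_range, Nat.lt_succ_iff]
  let anc : ℕ → ℕ → Finset (Σ _ : ℕ, ℕ) := fun n j =>
    {q ∈ I n | t q.1 q.2 ≤ t n j ∧ t n (j + k) ≤ t q.1 (q.2 + k)}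
  have hanc : ∀ n j q, q ∈ anc n j ↔ (q.1 ≤ n ∧ q.2 < m q.1) ∧
      t q.1 q.2 ≤ t n j ∧ t n (j + k) ≤ t q.1 (q.2 + k) := fun n j q => by
    rw [Finset.mem_filter, hI]
  let w : ℕ → ℕ → NNReal := fun n j => (anc n j).sup fun q => (ν q.1 q.2).toNNReal
  let g : ℕ → unitInterval → ℝ := fun n x =>
    ∑ j ∈ Finset.range (m n), (w n j : ℝ) * (ℱ n).bspline k j x
  have hgsp : ∀ n, (ℱ n).IsSpline k (g n) := fun n =>
    IsSpline.sum_mul _ _ fun j _ => isSpline_bspline hk j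
  have hg0 : ∀ n x, 0 ≤ g n x := fun n x =>
    Finset.sum_nonneg fun j _ => mul_nonneg (w n j).2 ((ℱ n).bspline_nonneg k j x)
  have hXm : ∀ n, Measurable fun x => Real.sqrt (∑ l ∈ Finset.range (n + 1), f l x ^ 2) :=
    fun n => (Finset.measurable_sum _ fun l hl => ((hsp n l hl).measurable.pow_const 2)).sqrt
  have hXint : ∀ n, Integrable fun x => Real.sqrt (∑ l ∈ Finset.range (n + 1), f l x ^ 2) := by
    intro n
    refine Integrable.of_bound (hXm n).aestronglyMeasurable (∑ j ∈ Finset.range (m n), ν n j)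
      (Filter.Eventually.of_forall fun x => ?_)
    rw [Real.norm_of_nonneg (Real.sqrt_nonneg _)]
    refine (hdom n x).trans (Finset.sum_le_sum fun j hj => ?_)
    exact mul_le_of_le_one_right (hν0 n j) ((ℱ n).bspline_le_one (Finset.mem_range.mp hj) x)
  refine ⟨g, fun n => ⟨hgsp n, hg0 n, fun x => ?_, fun x => ?_, ?_⟩⟩
  · refine sum_mul_bspline_le_of_refine (hℱ (Nat.le_succ n)) hk (fun i _ j _ h1 h2 => ?_) x
    refine NNReal.coe_le_coe.mpr (Finset.sup_mono fun q hq => ?_)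
    rw [hanc] at hq ⊢
    exact ⟨⟨hq.1.1.trans (Nat.le_succ n), hq.1.2⟩, hq.2.1.trans h1, h2.trans hq.2.2⟩
  · refine (hdom n x).trans (Finset.sum_le_sum fun j hj => ?_)
    refine mul_le_mul_of_nonneg_right ?_ ((ℱ n).bspline_nonneg k j x)
    have hmem : (⟨n, j⟩ : Σ _ : ℕ, ℕ) ∈ anc n j :=
      (hanc _ _ _).mpr ⟨⟨le_rfl, Finset.mem_range.mp hj⟩, le_rfl, le_rfl⟩
    exact (Real.le_coe_toNNReal _).trans (NNReal.coe_le_coe.mpr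
      (Finset.le_sup (f := fun q : Σ _ : ℕ, ℕ => (ν q.1 q.2).toNNReal) hmem))
  · rw [mul_assoc, ← integral_const_mul]
    refine integral_le_of_measure_lt_le (hgsp n).measurable (hg0 n)
      (fun x => mul_nonneg hC.le (Real.sqrt_nonneg _)) ((hXm n).const_mul C)
      ((hXint n).const_mul C) (by positivity) fun s hs => ?_
    let J : Finset (Σ _ : ℕ, ℕ) := {q ∈ I n | s < ν q.1 q.2}
    have hJ : ∀ q, q ∈ J ↔ (q.1 ≤ n ∧ q.2 < m q.1) ∧ s < ν q.1 q.2 := fun q => by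
      rw [Finset.mem_filter, hI]
    have hcover : Subtype.val '' {x | s < g n x} ⊆
        ⋃ q ∈ J, Set.Icc (t q.1 q.2) (t q.1 (q.2 + k)) := by
      rintro _ ⟨x, hx, rfl⟩
      -- A convex combination exceeds `s` only if one of the coefficients in it does.
      obtain ⟨j, hj, hN, hw⟩ : ∃ j ∈ Finset.range (m n),
          (ℱ n).bspline k j x ≠ 0 ∧ s < w n j := by
        by_contra! h
        refine absurd (show s < g n x from hx) (not_lt.mpr ?_)
        calc g n x ≤ ∑ j ∈ Finset.range (m n), s * (ℱ n).bspline k j x := by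
              refine Finset.sum_le_sum fun j hj => ?_
              by_cases hN : (ℱ n).bspline k j x = 0
              · rw [hN, mul_zero, mul_zero]
              · exact mul_le_mul_of_nonneg_right (h j hj hN) ((ℱ n).bspline_nonneg k j x)
          _ = s := by rw [← Finset.mul_sum, (ℱ n).sum_bspline, mul_one]
      have hw' : s.toNNReal < w n j := by rwa [Real.toNNReal_lt_iff_lt_coe hs.le]
      obtain ⟨q, hq, hsq⟩ := Finset.lt_sup_iff.mp hw'
      rw [hanc] at hq
      have hx' := mem_Icc_of_bspline_ne_zero hk hN
      refine Set.mem_iUnion₂.mpr ⟨q, (hJ q).mpr ⟨hq.1, ?_⟩, hq.2.1.trans hx'.1,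
        hx'.2.trans hq.2.2⟩
      exact (Real.toNNReal_lt_toNNReal_iff_of_nonneg hs.le).mp hsq
    have hGX : ⋃ q ∈ J, G q.1 q.2 ⊆ Subtype.val ''
        {x : unitInterval |
          s < C * Real.sqrt (∑ l ∈ Finset.range (n + 1), f l x ^ 2)} := by
      refine Set.iUnion₂_subset fun q hq y hy => ?_
      obtain ⟨⟨hq1, hq2⟩, hsq⟩ := (hJ q).mp hq
      obtain ⟨-, hG2, -, hG4⟩ := hG q.1 q.2 hq2
      let x : unitInterval := ⟨y, ((ℱ q.1).knot_nonneg k _).trans (hG2 hy).1,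
        (hG2 hy).2.trans ((ℱ q.1).knot_le_one k _)⟩
      refine ⟨x, ?_, rfl⟩
      refine hsq.trans_le ((hG4 x hy).trans
        (mul_le_mul_of_nonneg_left (Real.sqrt_le_sqrt ?_) hC.le))
      exact Finset.sum_le_sum_of_subset_of_nonneg
        (Finset.range_subset_range.mpr (by omega)) fun _ _ _ => sq_nonneg _
    rw [unitInterval.volume_apply, unitInterval.volume_apply]
    refine (measure_mono hcover).trans ((volume_biUnion_Icc_le J hc ?_ ?_ ?_).trans
      (mul_le_mul_right (measure_mono hGX) _))
    · exact fun q hq => (hG q.1 q.2 ((hJ q).mp hq).1.2).1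
    · exact fun q hq => (hG q.1 q.2 ((hJ q).mp hq).1.2).2.1
    · exact fun q hq => (hG q.1 q.2 ((hJ q).mp hq).1.2).2.2.1

end IntervalPartition

theorem mainTheorem5 :
    ∃ C : ℕ → ℝ → ℝ, ∀ k : ℕ, 1 ≤ k →
      ∀ ℱ : ℕ → IntervalPartition, Monotone (fun n => (ℱ n).sigmaAlgebra) →
      ∀ f : ℕ → unitInterval → ℝ, (∀ n, (ℱ n).IsSpline k (f n)) →
      ∃ g : ℕ → unitInterval → ℝ, ∀ n,
        (ℱ n).IsSpline k (g n) ∧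
        (∀ x, 0 ≤ g n x) ∧
        (∀ x, g n x ≤ g (n + 1) x) ∧
        (∀ x, Real.sqrt (∑ l ∈ Finset.range (n + 1), f l x ^ 2) ≤ g n x) ∧
        ∫ x, g n x ≤
          C k ((Finset.range (n + 1)).sup' Finset.nonempty_range_add_one
              (fun m => (ℱ m).regularity k)) *
            ∫ x, Real.sqrt (∑ l ∈ Finset.range (n + 1), f l x ^ 2) := by
  choose! D hD using fun k (hk : 1 ≤ k) => IntervalPartition.exists_monotone_splines hk
  exact ⟨fun k _ => D k, hD⟩
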